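/- Let $F\colon\mathbb{R}^d\to\mathbb{R}^d$ be $L$-Lipschitz, let $G\colon\mathbb{R}^d\rightrightarrows\mathbb{R}^d$ be set-valued, let $0<\rho<\eta$ with $\eta L<1$, and let $x^\star$ satisfy $0\in F(x^\star)+G(x^\star)$ and the $\rho$-weak Minty condition $$\langle u,x-x^\star\rangle\ge-\rho\|u\|^2\qquad\text{whenever } u\in F(x)+G(x).$$ Write $J_A=(\mathrm{Id}+A)^{-1}$ for the resolvent of $A$, $J=J_{\eta(F+G)}$, $\alpha=1-\rho/\eta$, $L_B=1+\eta L$, $\mu=1-\eta L$, $\kappa=L_B/\mu$, $\tau=\frac1{2L_B}$. Given $x_0\in\mathbb{R}^d$, the inexact Krasnosel'skii–Mann (KM) iteration is $$x_{k+1}=(1-\alpha)x_k+\alpha\,\widetilde J(x_k),\qquad k=0,1,2,\dots,$$ where $\widetilde J(x_k)\approx J(x_k)$ is computed by an inner solver. For $\varepsilon>0$ put $$M_\varepsilon=\max\Big\{1,\frac{\|x_0-x^\star\|^2}{(\eta-\rho)^2\varepsilon^2}\Big\},\qquad \delta_k=\frac{\eta\varepsilon^2}{(k+1)\log^2(k+3)}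 .$$ A first-order oracle call is at most one evaluation of $F$ and one resolvent of a positive multiple of $G$. At outer iteration $k$ put $B(z)=z+\eta F(z)-x_k$ and $z_0=x_k$. (i) Let $G\equiv0$, and let $\widetilde J(x_k)=z_{N_k}$, where $N_k=\lceil 4\kappa\log(8(k+1)\log^2(k+2))\rceil$ and, for $0\le t<N_k$, $z_{t+1/2}=J_{\tau\eta G}(z_t-\tau B(z_t))$ and $z_{t+1}=z_{t+1/2}+\tau B(z_t)-\tau B(z_{t+1/2})$ (forward-backward-forward; two oracle calls per step). There is a universal constant $c>0$ such that, for all data as above and all $\varepsilon>0$, there is an integer $K$ with $1\le K\le c\,M_\varepsilon$ such that $$\min_{0\le k\le K-1}\|F(x_k)\|\le2\varepsilon,$$ and the first $K$ outer iterations make at most $c\,\kappa\,M_\varepsilon\,(1+\log M_\varepsilon)$ oracle calls. (ii) Let $G=\partial\iota_C$ for a closed convex set $C\subseteq\mathbb{R}^d$, where $\iota_C$ is the indicator function of $C$. Then $J$ is single-valued with full domain. Let the extragradient solver with stopping criterion compute, for $t=0,1,\dots$, $z_{t+1/2}=J_{\tau\eta G}(z_t-\tau B(z_t))$ and $z_{t+1}=J_{\tau\eta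 G}(z_t-\tau B(z_{t+1/2}))$ (here $J_{\tau\eta G}$ is the projection onto $C$), stop at the first $t=T$ with $3L_B\|z_t-z_{t+1/2}\|\le\mu\,\delta_k$, and return $\widetilde J(x_k)=z_{T+1/2}$, at a cost of $2T+1$ oracle calls. There is a universal constant $c>0$ such that, for all data as above and all $\varepsilon>0$, the following hold. - In the KM iteration with this solver, the stopping test is met at every $k\ge0$, and $\|\widetilde J(x_k)-J(x_k)\|\le\delta_k$. - There is an integer $K$ with $1\le K\le c\,M_\varepsilon$ such that the first $K$ outer iterations with this solver make at most $c\,\kappa\,M_\varepsilon\,(1+\log(\kappa\,M_\varepsilon\max\{1,\varepsilon^{-1}\}))$ oracle calls. Moreover, for every inner solver that satisfies $\|\widetilde J(x_k)-J(x_k)\|\le\delta_k$ for all $k$ along its own KM run (in particular for the one above), for every $K'\ge K$, and for every $x^{\mathrm{out}}\in\arg\min_{x\in\{x_0,\dots,x_{K'-1}\}}\|x-\widetilde J(x)\|$ (where $\widetilde J(x_k)$ is the approximation computed at iteration $k$), $$\eta^{-1}\|(\mathrm{Id}-J)(x^{\mathrm{out}})\|\le2\varepsilon+3\varepsilon^2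 .$$ If, for some $b\ge0$, such a solver makes at most $b\,\kappa\,(1+\log(1+\kappa\|x_k-J(x_k)\|/\delta_k))$ oracle calls at each iteration $k$, then its first $K$ outer iterations make at most $c\,b\,\kappa\,M_\varepsilon\,(1+\log(\kappa\,M_\varepsilon\max\{1,\varepsilon^{-1}\}))$ oracle calls. -/

import Mathlib

open scoped NNReal

namespace WeakMVI

noncomputable section

/-! ### Set-valued operators -/

/-- The set-valued operator `F + G`, where `F` is single-valued and `G` is set-valued. -/
def opAdd {E : Type*} [AddCommGroup E] (F : E → E) (G : E → Set E) : E → Set E :=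
  fun x => {u | ∃ v ∈ G x, u = F x + v}

/-- The set-valued operator `c A`. -/
def opSMul {E : Type*} [AddCommGroup E] [Module ℝ E] (c : ℝ) (A : E → Set E) : E → Set E :=
  fun x => {u | ∃ v ∈ A x, u = c • v}

/-- The operator `G ≡ 0`. -/
def zeroOp {E : Type*} [AddCommGroup E] : E → Set E := fun _ => {0}

/-- The value at `x` of the set-valued resolvent `J_A = (Id + A)⁻¹`. -/
def opResolventSet {E : Type*} [AddCommGroup E] (A : E → Set E) (x : E) : Set E :=
  {z | ∃ v ∈ A z, x = z + v}

/-- The resolvent `J_A` as a map: the element of `opResolventSet A x` whenever that set is a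
singleton (an arbitrary point if it is empty). -/
def opResolvent {E : Type*} [AddCommGroup E] (A : E → Set E) (x : E) : E :=
  Classical.epsilon (fun z => z ∈ opResolventSet A x)

open Classical in
/-- The convex-analytic indicator `ι_C`: `0` on `C` and `+∞` outside. -/
def indicatorFn {E : Type*} (C : Set E) : E → EReal := fun x => if x ∈ C then 0 else ⊤

/-- The convex subdifferential `∂f` of an extended-valued function `f > -∞`
(empty outside the domain of `f`). -/
def subdifferential {E : Type*} [NormedAddCommGroup E] [InnerProductSpace ℝ E]
    (f : E → EReal) : E → Set E :=
  fun x => {v | f x ≠ ⊤ ∧ ∀ y, f x + ((inner ℝ v (y - x) : ℝ) : EReal) ≤ f y}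

/-- `xs` is a solution of `0 ∈ A(x)` that satisfies the `ρ`-weak Minty variational inequality
`⟨u, x - xs⟩ ≥ -ρ ‖u‖²` for all `(x, u)` in the graph of `A`. -/
def IsWeakMVISolution {E : Type*} [NormedAddCommGroup E] [InnerProductSpace ℝ E]
    (A : E → Set E) (ρ : ℝ) (xs : E) : Prop :=
  0 ∈ A xs ∧ ∀ x, ∀ u ∈ A x, inner ℝ u (x - xs) ≥ -ρ * ‖u‖ ^ 2

/-! ### Algorithms

Every procedure returns its output together with the number of first-order oracle calls it made.
A first-order oracle call consists of (at most) one evaluation of `F` and one resolvent of a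
positive multiple of `G`. -/

/-- The point `z_{t+1/2} = J_{τA}(z_t - τ B(z_t))`. -/
def halfPoint {E : Type*} [AddCommGroup E] [Module ℝ E]
    (τ : ℝ) (A : E → Set E) (B : E → E) (z : E) : E :=
  opResolvent (opSMul τ A) (z - τ • B z)

/-- One step of forward-backward-forward: `z_{t+1} = z_{t+1/2} + τ B(z_t) - τ B(z_{t+1/2})`. -/
def fbfStep {E : Type*} [AddCommGroup E] [Module ℝ E]
    (τ : ℝ) (A : E → Set E) (B : E → E) (z : E) : E :=
  halfPoint τ A B z + τ • B z - τ • B (halfPoint τ A B z)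

/-- `FBF(z₀, N, A, B_in, L_B)` with `τ = 1/(2 L_B)` and `B = B_in - z₀`. Each of the `N` steps
evaluates `B` at two points and one resolvent, which is counted as two oracle calls. -/
def fbf {E : Type*} [AddCommGroup E] [Module ℝ E]
    (z₀ : E) (N : ℕ) (A : E → Set E) (Bin : E → E) (LB : ℝ) : E × ℕ :=
  (fun s : E × ℕ => (fbfStep (1 / (2 * LB)) A (fun z => Bin z - z₀) s.1, s.2 + 2))^[N] (z₀, 0)

/-- One extragradient step: `z_{t+1} = J_{τA}(z_t - τ B(z_{t+1/2}))`. When `A` is the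
subdifferential of the indicator of a closed convex set, `J_{τA}` is the projection. -/
def egStep {E : Type*} [AddCommGroup E] [Module ℝ E]
    (τ : ℝ) (A : E → Set E) (B : E → E) (z : E) : E :=
  opResolvent (opSMul τ A) (z - τ • B (halfPoint τ A B z))

/-- The extragradient iterates `z_t` with `τ = 1/(2 L_B)` and `B = B_in - z₀`, from `z₀`. -/
def egIter {E : Type*} [AddCommGroup E] [Module ℝ E]
    (z₀ : E) (A : E → Set E) (Bin : E → E) (LB : ℝ) (t : ℕ) : E :=
  (egStep (1 / (2 * LB)) A (fun z => Bin z - z₀))^[t] z₀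

/-- The points `z_{t+1/2}` of the extragradient run. -/
def egHalf {E : Type*} [AddCommGroup E] [Module ℝ E]
    (z₀ : E) (A : E → Set E) (Bin : E → E) (LB : ℝ) (t : ℕ) : E :=
  halfPoint (1 / (2 * LB)) A (fun z => Bin z - z₀) (egIter z₀ A Bin LB t)

/-- The computable stopping test of the extragradient run for a `μ`-strongly monotone `B_in` and
target accuracy `δ`: `3 L_B ‖z_t - z_{t+1/2}‖ ≤ μ δ`. -/
def egStop {E : Type*} [NormedAddCommGroup E] [Module ℝ E]
    (z₀ : E) (A : E → Set E) (Bin : E → E) (LB μ δ : ℝ) (t : ℕ) : Prop :=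
  3 * LB * ‖egIter z₀ A Bin LB t - egHalf z₀ A Bin LB t‖ ≤ μ * δ

/-- Extragradient, stopped at the first `t = T` that passes the test, with output `z_{T+1/2}`
(meaningful when some `t` passes the test). Each of the `T` completed steps makes two oracle calls,
the last, incomplete one makes one. -/
def egSolve {E : Type*} [NormedAddCommGroup E] [Module ℝ E]
    (z₀ : E) (A : E → Set E) (Bin : E → E) (LB μ δ : ℝ) : E × ℕ :=
  (egHalf z₀ A Bin LB (sInf {t | egStop z₀ A Bin LB μ δ t}),
    2 * sInf {t | egStop z₀ A Bin LB μ δ t} + 1)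

/-- An inner solver: `S k x` is the approximation of `J_{η(F+G)}(x)` that is used at outer
iteration `k`, together with the number of oracle calls made to compute it. -/
abbrev InnerSolver (E : Type*) := ℕ → E → E × ℕ

/-- The inexact Krasnosel'skii-Mann iteration `x_{k+1} = (1 - α) x_k + α J̃(x_k)`, where `J̃(x_k)`
is computed by the inner solver `S`. `km S α x₀ k` is the pair of `x_k` and the number of oracle
calls made in the outer iterations `0, …, k-1`. -/
def km {E : Type*} [AddCommGroup E] [Module ℝ E]
    (S : InnerSolver E) (α : ℝ) (x₀ : E) : ℕ → E × ℕ
  | 0 => (x₀, 0)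
  | k + 1 =>
    ((1 - α) • (km S α x₀ k).1 + α • (S k (km S α x₀ k).1).1,
      (km S α x₀ k).2 + (S k (km S α x₀ k).1).2)

/-- The inner solver `FBF(x_k, N_k, η G, Id + η F, 1 + η L)` with
`N_k = ⌈4 (1 + η L) / (1 - η L) * log (8 (k + 1) log² (k + 2))⌉`. -/
def fbfSolver {E : Type*} [AddCommGroup E] [Module ℝ E]
    (F : E → E) (G : E → Set E) (η L : ℝ) : InnerSolver E :=
  fun k x => fbf x
    ⌈4 * (1 + η * L) / (1 - η * L) *
      Real.log (8 * ((k : ℝ) + 1) * Real.log ((k : ℝ) + 2) ^ 2)⌉₊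
    (opSMul η G) (fun z => z + η • F z) (1 + η * L)

/-- The accuracy `η ε² / ((k + 1) log² (k + 3))` prescribed for the inner solver. -/
def tol (η ε : ℝ) (k : ℕ) : ℝ :=
  η * ε ^ 2 / (((k : ℝ) + 1) * Real.log ((k : ℝ) + 3) ^ 2)

/-- The inner solver with stopping criterion: extragradient for the `(1 - η L)`-strongly monotone
and `(1 + η L)`-Lipschitz operator `Id + η F - x_k`, with target accuracy `tol η ε k`. -/
def egSolver {E : Type*} [NormedAddCommGroup E] [Module ℝ E]
    (F : E → E) (G : E → Set E) (η L ε : ℝ) : InnerSolver E :=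
  fun k x => egSolve x (opSMul η G) (fun z => z + η • F z) (1 + η * L) (1 - η * L) (tol η ε k)

/-- The inner solver `S` satisfies the error criterion
`‖J̃_{η(F+G)}(x_k) - J_{η(F+G)}(x_k)‖ ≤ tol η ε k` at every iterate `x_k` of its own run. -/
def MeetsTol {E : Type*} [NormedAddCommGroup E] [InnerProductSpace ℝ E]
    (F : E → E) (G : E → Set E) (η ε : ℝ) (S : InnerSolver E) (α : ℝ) (x₀ : E) : Prop :=
  ∀ k : ℕ, ‖(S k (km S α x₀ k).1).1 - opResolvent (opSMul η (opAdd F G)) (km S α x₀ k).1‖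
    ≤ tol η ε k

/-- The index `m` is a computable best iterate among `x_0, …, x_{K-1}`:
it minimizes `‖x_k - J̃(x_k)‖`. -/
def IsBestIterate {E : Type*} [NormedAddCommGroup E] [InnerProductSpace ℝ E]
    (S : InnerSolver E) (α : ℝ) (x₀ : E) (K m : ℕ) : Prop :=
  m < K ∧ ∀ k < K, ‖(km S α x₀ m).1 - (S m (km S α x₀ m).1).1‖
    ≤ ‖(km S α x₀ k).1 - (S k (km S α x₀ k).1).1‖

/-! ### Quantities in the complexity bounds -/

/-- The factor `(1 + η L) / (1 - η L)`. -/
def kappa (η L : ℝ) : ℝ := (1 + η * L) / (1 - η * L)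

/-- `max {1, D² / ((η - ρ)² ε²)}`, where `D = ‖x_0 - x*‖`. -/
def outerOrder (η ρ ε D : ℝ) : ℝ := max 1 (D ^ 2 / ((η - ρ) ^ 2 * ε ^ 2))

end

end WeakMVI

/-! If `z ∈ J(x)`, then `x - z = η u` with `u ∈ (F + G)(z)`. The weak Minty inequality at `z` gives
`⟨u, z - x*⟩ ≥ -ρ‖u‖²`, and moving from `z` to `x` gains `η‖u‖²`. Hence `Id - J` is quasi-cocoercive
at `x*` with constant `α = 1 - ρ/η` (`inner_sub_ge_of_isWeakMVISolution`). Relaxing by the same `α`,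
an exact KM step lowers `‖x - x*‖²` by at least `α²‖x - J x‖²`; an inexact one adds `α` times the
inner error to the distance (`norm_km_step_sq_le`). Summable errors, relative in (i) and absolute in
(ii), therefore preserve the energy bound. As `α η = η - ρ`, averaging over a multiple of `M`
iterations finds a residual of order `ηε` in (i) and `η(ε + ε²)` in (ii).

Each inner problem is a variational inequality for `B`, which is strongly monotone and Lipschitz
with condition number `κ`. Extragradient contracts by `exp(-1/(4κ))` per step
(`norm_egIter_sub_le`). For `G ≡ 0`, the normal cone of the whole space, forward-backward-forward is
the same method, so one analysis serves both parts. Starting from `x_k` makes the initial inner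
error equal to the outer residual: a prescribed number of steps gives relative accuracy. In (ii) an
a posteriori bound justifies the stopping test, and the residual is at most `‖x_k - x*‖/α`, so the
logarithm in the cost stays controlled (`absolute_error_log_le`). -/

namespace WeakMVI

/-! ### Normal cones, projections and the resolvent of `η(F + G)`. -/

section Operators

theorem opResolvent_mem {E : Type*} [AddCommGroup E] {A : E → Set E} {x : E}
    (h : (opResolventSet A x).Nonempty) : opResolvent A x ∈ opResolventSet A x :=
  Classical.epsilon_spec (p := fun z => z ∈ opResolventSet A x) h

variable {E : Type*} [NormedAddCommGroup E] [InnerProductSpace ℝ E]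

theorem mem_subdifferential_indicatorFn {C : Set E} {x v : E} :
    v ∈ subdifferential (indicatorFn C) x ↔ x ∈ C ∧ ∀ y ∈ C, inner ℝ v (y - x) ≤ 0 := by
  classical
  unfold subdifferential indicatorFn
  by_cases hx : x ∈ C
  · simp only [Set.mem_ofPred_eq, hx, if_true, true_and, zero_add]
    constructor
    · rintro ⟨-, h⟩ y hy
      have := h y
      rw [if_pos hy] at this
      exact_mod_cast this
    · intro h
      refine ⟨by simp, fun y => ?_⟩
      by_cases hy : y ∈ C
      · rw [if_pos hy]
        exact_mod_cast h y hy
      · rw [if_neg hy]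
        exact le_top
  · simp [hx]

/-- The subdifferential is the normal cone of `C`, hence invariant under positive scaling; every
resolvent in the algorithms is thus the projection onto `C`. -/
theorem opSMul_subdifferential_indicatorFn {C : Set E} {c : ℝ} (hc : 0 < c) :
    opSMul c (subdifferential (indicatorFn C)) = subdifferential (indicatorFn C) := by
  funext x
  ext v
  simp only [opSMul, Set.mem_ofPred_eq, mem_subdifferential_indicatorFn]
  constructor
  · rintro ⟨w, ⟨hx, hw⟩, rfl⟩
    refine ⟨hx, fun y hy => ?_⟩
    rw [real_inner_smul_left]
    exact mul_nonpos_of_nonneg_of_nonpos hc.le (hw y hy)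
  · rintro ⟨hx, hv⟩
    refine ⟨c⁻¹ • v, ⟨hx, fun y hy => ?_⟩, by rw [smul_smul, mul_inv_cancel₀ hc.ne', one_smul]⟩
    rw [real_inner_smul_left]
    exact mul_nonpos_of_nonneg_of_nonpos (inv_pos.2 hc).le (hv y hy)

theorem zeroOp_eq_subdifferential :
    (zeroOp : E → Set E) = subdifferential (indicatorFn Set.univ) := by
  funext x
  ext v
  simp only [zeroOp, Set.mem_singleton_iff, mem_subdifferential_indicatorFn, Set.mem_univ,
    true_and, true_implies]
  constructor
  · rintro rfl y
    simp
  · intro h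
    have := h (x + v)
    rw [add_sub_cancel_left] at this
    rw [real_inner_self_eq_norm_sq] at this
    exact norm_eq_zero.1 (pow_eq_zero_iff two_ne_zero |>.1 (le_antisymm this (sq_nonneg _)))

theorem mem_opResolventSet_subdifferential {C : Set E} {x z : E} :
    z ∈ opResolventSet (subdifferential (indicatorFn C)) x ↔
      z ∈ C ∧ ∀ y ∈ C, inner ℝ (x - z) (y - z) ≤ 0 := by
  simp only [opResolventSet, Set.mem_ofPred_eq]
  constructor
  · rintro ⟨v, hv, rfl⟩
    rw [add_sub_cancel_left]
    exact mem_subdifferential_indicatorFn.1 hv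
  · intro h
    exact ⟨x - z, mem_subdifferential_indicatorFn.2 h, by abel⟩

theorem mem_opResolventSet_opAdd {C : Set E} {F : E → E} {η : ℝ} (hη : 0 < η) {x z : E} :
    z ∈ opResolventSet (opSMul η (opAdd F (subdifferential (indicatorFn C)))) x ↔
      z ∈ C ∧ ∀ y ∈ C, inner ℝ (x - η • F z - z) (y - z) ≤ 0 := by
  rw [← mem_opResolventSet_subdifferential]
  constructor
  · rintro ⟨_, ⟨_, ⟨v, hv, rfl⟩, rfl⟩, h⟩
    rw [← opSMul_subdifferential_indicatorFn hη]
    exact ⟨η • v, ⟨v, hv, rfl⟩, by rw [h]; module⟩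
  · intro h
    rw [← opSMul_subdifferential_indicatorFn hη] at h
    obtain ⟨_, ⟨v, hv, rfl⟩, h⟩ := h
    exact ⟨_, ⟨_, ⟨v, hv, rfl⟩, rfl⟩, by rw [sub_eq_iff_eq_add.1 h]; module⟩

/-- Each variational inequality is tested at the other point and the two are added. The case `x = y`
gives uniqueness of the projection. -/
theorem norm_sub_le_of_projection {C : Set E} {x y p q : E}
    (hp : p ∈ C ∧ ∀ w ∈ C, inner ℝ (x - p) (w - p) ≤ 0)
    (hq : q ∈ C ∧ ∀ w ∈ C, inner ℝ (y - q) (w - q) ≤ 0) : ‖p - q‖ ≤ ‖x - y‖ := by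
  have h1 := hp.2 q hq.1
  have h2 := hq.2 p hp.1
  have h3 : ‖p - q‖ ^ 2 ≤ inner ℝ (x - y) (p - q) := by
    rw [← real_inner_self_eq_norm_sq]
    have e1 : inner ℝ (x - p) (q - p) = -inner ℝ (x - p) (p - q) := by
      rw [← inner_neg_right, neg_sub]
    have e2 : inner ℝ (x - y) (p - q) - inner ℝ (p - q) (p - q)
        = inner ℝ (x - p) (p - q) - inner ℝ (y - q) (p - q) := by
      rw [← inner_sub_left, ← inner_sub_left]
      congr 1
      abel
    linarith
  have h4 := real_inner_le_norm (x - y) (p - q)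
  by_contra! h
  nlinarith [norm_nonneg (x - y), norm_nonneg (p - q)]

variable [CompleteSpace E]

theorem exists_projection {C : Set E} (hne : C.Nonempty) (hc : Convex ℝ C) (hcl : IsClosed C)
    (x : E) : ∃ z ∈ C, ∀ y ∈ C, inner ℝ (x - z) (y - z) ≤ 0 := by
  obtain ⟨z, hz, h⟩ := exists_norm_eq_iInf_of_complete_convex hne hcl.isComplete hc x
  exact ⟨z, hz, (norm_eq_iInf_iff_real_inner_le_zero hc hz).1 h⟩

/-- The resolvent values at `x` are the fixed points of `z ↦ P (x - η F z)`, a contraction because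
`P` is nonexpansive and `η L < 1`. -/
theorem opResolventSet_opAdd_eq_singleton {C : Set E} {F : E → E} {L : ℝ≥0} {η : ℝ}
    (hF : LipschitzWith L F) (hne : C.Nonempty) (hc : Convex ℝ C) (hcl : IsClosed C)
    (hη : 0 < η) (hηL : η * L < 1) (x : E) :
    opResolventSet (opSMul η (opAdd F (subdifferential (indicatorFn C)))) x =
      {opResolvent (opSMul η (opAdd F (subdifferential (indicatorFn C)))) x} := by
  choose P hP using exists_projection hne hc hcl
  have hPP : ∀ x, P x ∈ C ∧ ∀ y ∈ C, inner ℝ (x - P x) (y - P x) ≤ 0 := hP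
  have hchar : ∀ z, z ∈ opResolventSet (opSMul η (opAdd F (subdifferential (indicatorFn C)))) x ↔
      P (x - η • F z) = z := by
    intro z
    rw [mem_opResolventSet_opAdd hη]
    constructor
    · intro h
      have := norm_sub_le_of_projection (hPP (x - η • F z)) h
      rw [sub_self, norm_zero] at this
      exact sub_eq_zero.1 (norm_le_zero_iff.1 this)
    · intro h
      have := hPP (x - η • F z)
      rwa [h] at this
  have hK : ContractingWith (η.toNNReal * L) (fun z => P (x - η • F z)) := by
    constructor
    · rw [← NNReal.coe_lt_coe]
      simpa [hη.le] using hηL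
    · refine LipschitzWith.of_dist_le_mul fun z w => ?_
      rw [dist_eq_norm, dist_eq_norm]
      refine (norm_sub_le_of_projection (hPP _) (hPP _)).trans ?_
      have : x - η • F z - (x - η • F w) = η • (F w - F z) := by module
      rw [this, norm_smul, Real.norm_eq_abs, abs_of_pos hη, norm_sub_rev]
      have := hF.norm_sub_le z w
      push_cast
      rw [Real.coe_toNNReal _ hη.le, mul_assoc]
      gcongr
  have hfix := hK.fixedPoint_isFixedPt
  have hmem := opResolvent_mem ⟨_, (hchar _).2 hfix⟩
  ext z
  rw [Set.mem_singleton_iff]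
  refine ⟨fun h => ?_, fun h => h ▸ hmem⟩
  exact hK.fixedPoint_unique' ((hchar z).1 h) ((hchar _).1 hmem)

end Operators

/-! ### Energy estimates for the inexact Krasnosel'skii–Mann iteration. -/

section KrasnoselskiiMann

variable {E : Type*} [NormedAddCommGroup E] [InnerProductSpace ℝ E]

/-- The residual `Id - J` at a point of the resolvent of `η A` is `α`-quasi-cocoercive. -/
theorem inner_sub_ge_of_isWeakMVISolution {A : E → Set E} {ρ η : ℝ} {xs x z : E}
    (hxs : IsWeakMVISolution A ρ xs) (hη : 0 < η) (hz : z ∈ opResolventSet (opSMul η A) x) :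
    (1 - ρ / η) * ‖x - z‖ ^ 2 ≤ inner ℝ (x - z) (x - xs) := by
  obtain ⟨_, ⟨u, hu, rfl⟩, rfl⟩ := hz
  have h := hxs.2 z u hu
  rw [add_sub_cancel_left, norm_smul, real_inner_smul_left, Real.norm_eq_abs, abs_of_pos hη]
  have e : inner ℝ u (z + η • u - xs) = inner ℝ u (z - xs) + η * ‖u‖ ^ 2 := by
    rw [← real_inner_self_eq_norm_sq, ← real_inner_smul_right, ← inner_add_right]
    congr 1
    abel
  rw [e]
  have : (1 - ρ / η) * (η * ‖u‖) ^ 2 = η * (-ρ * ‖u‖ ^ 2 + η * ‖u‖ ^ 2) := by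
    field_simp
    ring
  rw [this]
  gcongr

theorem mul_norm_sub_le_of_inner_ge {α : ℝ} {x z xs : E}
    (h : α * ‖x - z‖ ^ 2 ≤ inner ℝ (x - z) (x - xs)) : α * ‖x - z‖ ≤ ‖x - xs‖ := by
  have h1 := real_inner_le_norm (x - z) (x - xs)
  rcases (norm_nonneg (x - z)).eq_or_lt with h0 | h0
  · rw [← h0]
    simp
  · by_contra! hlt
    nlinarith

/-- For the exact step `w`, expanding the square gives a cross term at most `-2α²‖x - z‖²` against
`+α²‖x - z‖²`. Replacing `z` by `y` moves the step by `α (y - z)`. -/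
theorem norm_km_step_sq_le {α : ℝ} (hα : 0 ≤ α) {x y z xs : E}
    (h : α * ‖x - z‖ ^ 2 ≤ inner ℝ (x - z) (x - xs)) :
    ‖(1 - α) • x + α • y - xs‖ ^ 2 + α ^ 2 * ‖x - z‖ ^ 2 ≤
      (‖x - xs‖ + α * ‖y - z‖) ^ 2 := by
  set w := x - xs - α • (x - z) with hw
  have hws : ‖w‖ ^ 2 ≤ ‖x - xs‖ ^ 2 - α ^ 2 * ‖x - z‖ ^ 2 := by
    rw [hw, norm_sub_sq_real, real_inner_smul_right, norm_smul, Real.norm_eq_abs, mul_pow, sq_abs,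
      real_inner_comm]
    nlinarith
  have hwd : ‖w‖ ≤ ‖x - xs‖ := by
    refine le_of_sq_le_sq ?_ (norm_nonneg _)
    nlinarith [sq_nonneg (α * ‖x - z‖)]
  have e : (1 - α) • x + α • y - xs = w + α • (y - z) := by
    rw [hw]
    module
  have ht : ‖(1 - α) • x + α • y - xs‖ ≤ ‖w‖ + α * ‖y - z‖ := by
    rw [e]
    refine (norm_add_le _ _).trans_eq ?_
    rw [norm_smul, Real.norm_eq_abs, abs_of_nonneg hα]
  have h2 := pow_le_pow_left₀ (norm_nonneg _) ht 2
  have h3 : 0 ≤ α * ‖y - z‖ := by positivity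
  nlinarith [mul_le_mul_of_nonneg_left hwd h3]

/-- Energy estimate for the inexact iteration under absolute errors. -/
theorem km_energy_le {S : InnerSolver E} {J : E → E} {α : ℝ} (hα : 0 ≤ α) {x₀ xs : E}
    (hJ : ∀ x, α * ‖x - J x‖ ^ 2 ≤ inner ℝ (x - J x) (x - xs)) {δ : ℕ → ℝ}
    (hS : ∀ k, ‖(S k (km S α x₀ k).1).1 - J (km S α x₀ k).1‖ ≤ δ k) (n : ℕ) :
    ‖(km S α x₀ n).1 - xs‖ ^ 2 +
        α ^ 2 * ∑ k ∈ Finset.range n, ‖(km S α x₀ k).1 - J (km S α x₀ k).1‖ ^ 2 ≤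
      (‖x₀ - xs‖ + α * ∑ k ∈ Finset.range n, δ k) ^ 2 := by
  have hδ : ∀ k, 0 ≤ δ k := fun k => (norm_nonneg _).trans (hS k)
  induction n with
  | zero => simp [km]
  | succ n ih =>
    rw [Finset.sum_range_succ, Finset.sum_range_succ]
    have h1 := norm_km_step_sq_le hα (y := (S n (km S α x₀ n).1).1) (hJ (km S α x₀ n).1)
    have h2 : (km S α x₀ (n + 1)).1 =
      (1 - α) • (km S α x₀ n).1 + α • (S n (km S α x₀ n).1).1 := rfl
    rw [h2]
    set d := ‖(km S α x₀ n).1 - xs‖ with hd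
    set R := ∑ k ∈ Finset.range n, ‖(km S α x₀ k).1 - J (km S α x₀ k).1‖ ^ 2 with hR
    have hR0 : 0 ≤ R := Finset.sum_nonneg fun _ _ => by positivity
    have hs0 : 0 ≤ ‖x₀ - xs‖ + α * ∑ k ∈ Finset.range n, δ k := by
      have := Finset.sum_nonneg fun k (_ : k ∈ Finset.range n) => hδ k
      positivity
    set s := ‖x₀ - xs‖ + α * ∑ k ∈ Finset.range n, δ k with hs
    -- Dropping the residual sum from the induction hypothesis bounds the distance, so the cross
    -- term `2 d α δ n` fits into `(s + α δ n)²`.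
    have hds : d ≤ s := by
      refine le_of_sq_le_sq ?_ hs0
      nlinarith [mul_nonneg (sq_nonneg α) hR0]
    have h3 : (d + α * ‖(S n (km S α x₀ n).1).1 - J (km S α x₀ n).1‖) ^ 2 ≤ (d + α * δ n) ^ 2 := by
      have := hS n
      gcongr
    have h4 : d * (α * δ n) ≤ s * (α * δ n) :=
      mul_le_mul_of_nonneg_right hds (mul_nonneg hα (hδ n))
    have h5 : ‖x₀ - xs‖ + α * (∑ k ∈ Finset.range n, δ k + δ n) = s + α * δ n := by
      rw [hs]
      ring
    rw [h5]
    nlinarith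

/-- Energy estimate for the inexact iteration under relative errors. -/
theorem km_energy_le_of_relative_error {S : InnerSolver E} {J : E → E} {α : ℝ} (hα : 0 ≤ α)
    {x₀ xs : E} (hJ : ∀ x, α * ‖x - J x‖ ^ 2 ≤ inner ℝ (x - J x) (x - xs)) {θ : ℕ → ℝ}
    (hθ : ∀ k, 0 ≤ θ k)
    (hS : ∀ k x, ‖(S k x).1 - J x‖ ≤ θ k * ‖x - J x‖) (n : ℕ) :
    ‖(km S α x₀ n).1 - xs‖ ^ 2 +
        α ^ 2 * ∑ k ∈ Finset.range n, ‖(km S α x₀ k).1 - J (km S α x₀ k).1‖ ^ 2 ≤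
      Real.exp (2 * ∑ k ∈ Finset.range n, θ k) * ‖x₀ - xs‖ ^ 2 := by
  induction n with
  | zero => simp [km]
  | succ n ih =>
    rw [Finset.sum_range_succ, Finset.sum_range_succ]
    set x := (km S α x₀ n).1 with hx
    have h1 := norm_km_step_sq_le hα (y := (S n x).1) (hJ x)
    have h2 : (km S α x₀ (n + 1)).1 = (1 - α) • x + α • (S n x).1 := rfl
    rw [h2, mul_add, mul_add 2, Real.exp_add]
    set d := ‖x - xs‖ with hd
    set R := ∑ k ∈ Finset.range n, ‖(km S α x₀ k).1 - J (km S α x₀ k).1‖ ^ 2 with hR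
    have hR0 : 0 ≤ α ^ 2 * R :=
      mul_nonneg (sq_nonneg _) (Finset.sum_nonneg fun _ _ => by positivity)
    -- Since `α‖x - J x‖ ≤ d`, a relative error `θ n` enlarges the distance by at most `1 + θ n ≤
    -- exp (θ n)`.
    have h3 : d + α * ‖(S n x).1 - J x‖ ≤ Real.exp (θ n) * d := by
      have a1 := mul_le_mul_of_nonneg_left (hS n x) hα
      have a2 := mul_le_mul_of_nonneg_left (mul_norm_sub_le_of_inner_ge (hJ x)) (hθ n)
      have a3 := mul_le_mul_of_nonneg_right (Real.add_one_le_exp (θ n)) (norm_nonneg (x - xs))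
      linarith
    have h4 : (d + α * ‖(S n x).1 - J x‖) ^ 2 ≤ Real.exp (2 * θ n) * d ^ 2 := by
      have := pow_le_pow_left₀ (by positivity) h3 2
      rwa [mul_pow, ← Real.exp_nat_mul, Nat.cast_ofNat] at this
    have h5 : 1 ≤ Real.exp (2 * θ n) := Real.one_le_exp (by linarith [hθ n])
    have h6 := mul_le_mul_of_nonneg_left ih (Real.exp_pos (2 * θ n)).le
    nlinarith

end KrasnoselskiiMann

/-! ### One extragradient step for a strongly monotone Lipschitz operator. -/

section Extragradient

theorem eg_contraction_factor_le_exp {p : ℝ} (hp : 0 < p) (hp1 : p ≤ 1) :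
    (3 + p) / (3 + 4 * p) ≤ Real.exp (-(p / 2)) := by
  have h := (abs_le.1 (Real.abs_exp_sub_one_sub_id_le (x := p / 2)
    (by rw [abs_of_pos (by linarith)]; linarith))).2
  rw [Real.exp_neg, div_le_iff₀ (by linarith), inv_mul_eq_div, le_div_iff₀ (Real.exp_pos _)]
  have h2 : Real.exp (p / 2) ≤ 1 + p / 2 + (p / 2) ^ 2 := by linarith
  have h3 := mul_le_mul_of_nonneg_left h2 (by linarith : 0 ≤ 3 + p)
  nlinarith [mul_nonneg hp.le (sub_nonneg.2 hp1), mul_nonneg (mul_nonneg hp.le hp.le) (sub_nonneg.2 hp1)]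

/-- With `a = ‖z - h‖` and `b = ‖h - zs‖`, the minimum of `3/4 a² + p b²` subject to `a + b ≥ ‖z -
zs‖` is `3p/(3 + 4p) ‖z - zs‖²`, attained when `3a = 4pb`. -/
theorem eg_step_contraction {p : ℝ} (hp : 0 < p) (hp1 : p ≤ 1) {E : Type*}
    [NormedAddCommGroup E] {z h z' zs : E}
    (H : ‖z' - zs‖ ^ 2 + 3 / 4 * ‖z - h‖ ^ 2 + p * ‖h - zs‖ ^ 2 ≤ ‖z - zs‖ ^ 2) :
    ‖z' - zs‖ ≤ Real.exp (-(p / 4)) * ‖z - zs‖ := by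
  have ht : ‖z - zs‖ ≤ ‖z - h‖ + ‖h - zs‖ := norm_sub_le_norm_sub_add_norm_sub _ _ _
  have h1 : 3 * p / (3 + 4 * p) * ‖z - zs‖ ^ 2 ≤ 3 / 4 * ‖z - h‖ ^ 2 + p * ‖h - zs‖ ^ 2 := by
    rw [div_mul_eq_mul_div, div_le_iff₀ (by linarith)]
    have h2 := pow_le_pow_left₀ (norm_nonneg _) ht 2
    have h3 := mul_le_mul_of_nonneg_left h2 (by linarith : 0 ≤ 3 * p)
    nlinarith [sq_nonneg (3 * ‖z - h‖ - 4 * p * ‖h - zs‖)]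
  have h4 : ‖z' - zs‖ ^ 2 ≤ (3 + p) / (3 + 4 * p) * ‖z - zs‖ ^ 2 := by
    have : (3 + p) / (3 + 4 * p) = 1 - 3 * p / (3 + 4 * p) := by
      field_simp
      ring
    rw [this]
    linarith
  have h5 := mul_le_mul_of_nonneg_right (eg_contraction_factor_le_exp hp hp1)
    (sq_nonneg ‖z - zs‖)
  refine le_of_sq_le_sq ?_ (by positivity)
  rw [mul_pow, ← Real.exp_nat_mul]
  have : ((2 : ℕ) : ℝ) * -(p / 4) = -(p / 2) := by
    push_cast
    ring
  rw [this]
  linarith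

variable {E : Type*} [NormedAddCommGroup E] [InnerProductSpace ℝ E]

/-- The projection inequality for `h` is tested at `z'` and that for `z'` at `zs`. Because `τ LB =
1/2`, the Lipschitz error is at most `‖z - h‖ ‖z' - h‖ ≤ ‖z' - h‖² + ‖z - h‖²/4`, which leaves the
coefficient `3/4`; strong monotonicity supplies the last term. -/
theorem eg_step_norm_sq_le {B : E → E} {LB μ : ℝ} (hLB : 0 < LB) {z h z' zs : E}
    (hLip : ‖B h - B z‖ ≤ LB * ‖h - z‖)
    (hmono : μ * ‖h - zs‖ ^ 2 ≤ inner ℝ (B h - B zs) (h - zs))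
    (hh : inner ℝ (z - (1 / (2 * LB)) • B z - h) (z' - h) ≤ 0)
    (hz' : inner ℝ (z - (1 / (2 * LB)) • B h - z') (zs - z') ≤ 0)
    (hzs : 0 ≤ inner ℝ (B zs) (h - zs)) :
    ‖z' - zs‖ ^ 2 + 3 / 4 * ‖z - h‖ ^ 2 + μ / LB * ‖h - zs‖ ^ 2 ≤ ‖z - zs‖ ^ 2 := by
  have hτ : LB * (1 / (2 * LB)) = 1 / 2 := by field_simp
  have hμ : μ / LB = 2 * (1 / (2 * LB)) * μ := by field_simp
  have hτ0 : 0 < 1 / (2 * LB) := by positivity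
  rw [hμ]
  set τ := 1 / (2 * LB) with hτdef
  have e1 : ‖z' - zs‖ ^ 2 + ‖z - z'‖ ^ 2 - ‖z - zs‖ ^ 2 = 2 * inner ℝ (z - z') (zs - z') := by
    have : z - zs = (z - z') - (zs - z') := by abel
    rw [this, norm_sub_sq_real (z - z'), norm_sub_rev zs z']
    ring
  have e2 : ‖z - z'‖ ^ 2 - ‖z - h‖ ^ 2 - ‖z' - h‖ ^ 2 = -2 * inner ℝ (z - h) (z' - h) := by
    have : z - z' = (z - h) - (z' - h) := by abel
    rw [this, norm_sub_sq_real (z - h)]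
    ring
  have e3 : inner ℝ (z - τ • B z - h) (z' - h) =
      inner ℝ (z - h) (z' - h) - τ * inner ℝ (B z) (z' - h) := by
    rw [← real_inner_smul_left, ← inner_sub_left]
    congr 1
    abel
  have e4 : inner ℝ (z - τ • B h - z') (zs - z') =
      inner ℝ (z - z') (zs - z') - τ * inner ℝ (B h) (zs - z') := by
    rw [← real_inner_smul_left, ← inner_sub_left]
    congr 1
    abel
  have e5 : inner ℝ (B h) (zs - z') = -inner ℝ (B h) (h - zs) - inner ℝ (B h) (z' - h) := by
    rw [← inner_neg_right, ← inner_sub_right]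
    congr 1
    abel
  have e6 : inner ℝ (B h - B z) (z' - h) = inner ℝ (B h) (z' - h) - inner ℝ (B z) (z' - h) :=
    inner_sub_left _ _ _
  have e7 : inner ℝ (B h - B zs) (h - zs) = inner ℝ (B h) (h - zs) - inner ℝ (B zs) (h - zs) :=
    inner_sub_left _ _ _
  have h1 : -(τ * inner ℝ (B h - B z) (z' - h)) ≤ 1 / 2 * (‖z - h‖ * ‖z' - h‖) := by
    have a1 := neg_le_of_abs_le (abs_real_inner_le_norm (B h - B z) (z' - h))
    have a2 := mul_le_mul_of_nonneg_right hLip (norm_nonneg (z' - h))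
    have a3 : -inner ℝ (B h - B z) (z' - h) ≤ LB * (‖z - h‖ * ‖z' - h‖) := by
      rw [norm_sub_rev z h]
      linarith
    have := mul_le_mul_of_nonneg_left a3 hτ0.le
    calc _ = τ * -inner ℝ (B h - B z) (z' - h) := by ring
      _ ≤ _ := this
      _ = (LB * τ) * (‖z - h‖ * ‖z' - h‖) := by ring
      _ = _ := by rw [hτ]
  have h2 : τ * (μ * ‖h - zs‖ ^ 2) ≤ τ * inner ℝ (B h) (h - zs) := by
    gcongr
    linarith
  rw [e4, e5] at hz'
  rw [e3] at hh
  rw [e6] at h1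
  nlinarith [sq_nonneg (‖z' - h‖ - 1 / 2 * ‖z - h‖)]

/-- A posteriori bound behind the stopping test: the projection inequality contributes `2 LB` and
replacing `B z` by `B h` contributes `LB`. -/
theorem norm_half_sub_le {B : E → E} {LB μ : ℝ} (hLB : 0 < LB) {z h zs : E}
    (hLip : ‖B h - B z‖ ≤ LB * ‖h - z‖)
    (hmono : μ * ‖h - zs‖ ^ 2 ≤ inner ℝ (B h - B zs) (h - zs))
    (hh : inner ℝ (z - (1 / (2 * LB)) • B z - h) (zs - h) ≤ 0)
    (hzs : 0 ≤ inner ℝ (B zs) (h - zs)) :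
    μ * ‖h - zs‖ ≤ 3 * LB * ‖z - h‖ := by
  have e3 : inner ℝ (z - (1 / (2 * LB)) • B z - h) (zs - h) =
      1 / (2 * LB) * inner ℝ (B z) (h - zs) - inner ℝ (z - h) (h - zs) := by
    rw [← real_inner_smul_left, ← inner_sub_left, ← neg_sub h zs, inner_neg_right,
      ← inner_neg_left]
    congr 1
    abel
  have h1 : inner ℝ (B z) (h - zs) ≤ 2 * LB * inner ℝ (z - h) (h - zs) := by
    rw [e3, sub_nonpos, div_mul_eq_mul_div, one_mul, div_le_iff₀ (by positivity)] at hh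
    linarith
  have h2 := real_inner_le_norm (z - h) (h - zs)
  have h3 := real_inner_le_norm (B h - B z) (h - zs)
  have h4 := mul_le_mul_of_nonneg_right hLip (norm_nonneg (h - zs))
  rw [inner_sub_left] at hmono h3
  rw [norm_sub_rev h z] at h4
  have h5 := mul_le_mul_of_nonneg_left h2 (by positivity : 0 ≤ 2 * LB)
  have h6 : μ * ‖h - zs‖ ^ 2 ≤ 3 * LB * ‖z - h‖ * ‖h - zs‖ := by linarith
  rcases (norm_nonneg (h - zs)).eq_or_lt with h0 | h0
  · rw [← h0, mul_zero]
    positivity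
  · exact le_of_mul_le_mul_right (by linarith) h0

end Extragradient

/-! ### Accuracy and cost of the two inner solvers. -/

section InnerSolvers

variable {E : Type*} [NormedAddCommGroup E] [InnerProductSpace ℝ E]

theorem lipschitz_regularized {F : E → E} {L : ℝ≥0} {η : ℝ} (hF : LipschitzWith L F) (hη : 0 < η)
    (x y z : E) : ‖y + η • F y - x - (z + η • F z - x)‖ ≤ (1 + η * L) * ‖y - z‖ := by
  have e : y + η • F y - x - (z + η • F z - x) = (y - z) + η • (F y - F z) := by module
  rw [e]
  refine (norm_add_le _ _).trans ?_
  rw [norm_smul, Real.norm_eq_abs, abs_of_pos hη]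
  have := mul_le_mul_of_nonneg_left (hF.norm_sub_le y z) hη.le
  linarith

theorem strongly_monotone_regularized {F : E → E} {L : ℝ≥0} {η : ℝ} (hF : LipschitzWith L F)
    (hη : 0 < η) (x y z : E) :
    (1 - η * L) * ‖y - z‖ ^ 2 ≤ inner ℝ (y + η • F y - x - (z + η • F z - x)) (y - z) := by
  have e : y + η • F y - x - (z + η • F z - x) = (y - z) + η • (F y - F z) := by module
  rw [e, inner_add_left, real_inner_self_eq_norm_sq, real_inner_smul_left]
  have h1 := neg_le_of_abs_le (abs_real_inner_le_norm (F y - F z) (y - z))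
  have h2 := mul_le_mul_of_nonneg_right (hF.norm_sub_le y z) (norm_nonneg (y - z))
  have h3 : -(L * ‖y - z‖ * ‖y - z‖) ≤ inner ℝ (F y - F z) (y - z) := by linarith
  have := mul_le_mul_of_nonneg_left h3 hη.le
  nlinarith

theorem one_le_kappa {L : ℝ≥0} {η : ℝ} (hη : 0 < η) (hηL : η * L < 1) : 1 ≤ kappa η L := by
  have : 0 ≤ η * (L : ℝ) := by positivity
  unfold kappa
  rw [one_le_div (by linarith)]
  linarith

theorem opResolvent_smul_zeroOp {E : Type*} [AddCommGroup E] [Module ℝ E] (τ η : ℝ) (x : E) :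
    opResolvent (opSMul τ (opSMul η (zeroOp : E → Set E))) x = x := by
  have h := opResolvent_mem (A := opSMul τ (opSMul η (zeroOp : E → Set E))) (x := x)
    ⟨x, 0, ⟨0, ⟨0, rfl, by simp⟩, by simp⟩, by simp⟩
  obtain ⟨_, ⟨_, ⟨_, rfl, rfl⟩, rfl⟩, h⟩ := h
  rw [smul_zero, smul_zero, add_zero] at h
  exact h.symm

/-- With the identity as resolvent, both steps equal `z - τ B (z - τ B z)`. -/
theorem fbfStep_zeroOp {E : Type*} [AddCommGroup E] [Module ℝ E] (τ η : ℝ) (B : E → E) (z : E) :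
    fbfStep τ (opSMul η (zeroOp : E → Set E)) B z =
      egStep τ (opSMul η (zeroOp : E → Set E)) B z := by
  simp only [fbfStep, egStep, halfPoint, opResolvent_smul_zeroOp]
  abel

theorem fbf_zeroOp {E : Type*} [AddCommGroup E] [Module ℝ E] (x : E) (N : ℕ) (η : ℝ)
    (Bin : E → E) (LB : ℝ) :
    fbf x N (opSMul η (zeroOp : E → Set E)) Bin LB =
      (egIter x (opSMul η (zeroOp : E → Set E)) Bin LB N, 2 * N) := by
  unfold fbf
  induction N with
  | zero => rfl
  | succ N ih =>
    rw [Function.iterate_succ_apply', ih]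
    simp only [fbfStep_zeroOp, egIter, Function.iterate_succ_apply']
    rfl

theorem fbfSolver_cost_le {F : E → E} {L : ℝ≥0} {η : ℝ} (hη : 0 < η) (hηL : η * L < 1) (k : ℕ) (x : E) :
    ((fbfSolver F zeroOp η L k x).2 : ℝ) ≤
      kappa η L * (2 + 8 * (Real.log 8 + 3 * Real.log (k + 2))) := by
  have hκ := one_le_kappa hη hηL
  unfold fbfSolver
  rw [fbf_zeroOp]
  have hk0 : (0 : ℝ) ≤ k := k.cast_nonneg
  have hl : 0 < Real.log ((k : ℝ) + 2) := Real.log_pos (by linarith)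
  have hl2 : Real.log ((k : ℝ) + 2) ≤ k + 2 := (Real.log_le_self (by linarith))
  have h1 : Real.log (8 * ((k : ℝ) + 1) * Real.log ((k : ℝ) + 2) ^ 2) ≤
      Real.log 8 + 3 * Real.log (k + 2) := by
    have e : Real.log 8 + 3 * Real.log ((k : ℝ) + 2) =
        Real.log (8 * ((k : ℝ) + 2) * ((k : ℝ) + 2) ^ 2) := by
      rw [Real.log_mul (by positivity) (by positivity), Real.log_mul (by positivity)
        (by positivity), Real.log_pow]
      push_cast
      ring
    rw [e]
    apply Real.log_le_log (by positivity)
    gcongr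
    norm_num
  have hlog : 0 ≤ Real.log 8 + 3 * Real.log ((k : ℝ) + 2) := by
    have := Real.log_nonneg (show (1 : ℝ) ≤ 8 by norm_num)
    positivity
  have h2 : 4 * (1 + η * L) / (1 - η * L) *
      Real.log (8 * ((k : ℝ) + 1) * Real.log ((k : ℝ) + 2) ^ 2) ≤
      4 * kappa η L * (Real.log 8 + 3 * Real.log (k + 2)) := by
    rw [mul_div_assoc]
    have : 0 ≤ 4 * kappa η L := by positivity
    exact mul_le_mul_of_nonneg_left h1 this
  have h3 := (Nat.ceil_le_ceil h2)
  have h4 := (Nat.ceil_lt_add_one (by positivity :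
    0 ≤ 4 * kappa η L * (Real.log 8 + 3 * Real.log ((k : ℝ) + 2)))).le
  have h5 := (Nat.cast_le (α := ℝ)).2 h3
  push_cast
  nlinarith

variable [CompleteSpace E]

theorem opResolvent_smul_subdifferential_spec {C : Set E} (hne : C.Nonempty) (hc : Convex ℝ C)
    (hcl : IsClosed C) {τ η : ℝ} (hτ : 0 < τ) (hη : 0 < η) (x : E) :
    opResolvent (opSMul τ (opSMul η (subdifferential (indicatorFn C)))) x ∈ C ∧
      ∀ y ∈ C, inner ℝ
        (x - opResolvent (opSMul τ (opSMul η (subdifferential (indicatorFn C)))) x)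
        (y - opResolvent (opSMul τ (opSMul η (subdifferential (indicatorFn C)))) x) ≤ 0 := by
  rw [opSMul_subdifferential_indicatorFn hη, opSMul_subdifferential_indicatorFn hτ,
    ← mem_opResolventSet_subdifferential]
  obtain ⟨z, hz⟩ := exists_projection hne hc hcl x
  exact opResolvent_mem ⟨z, mem_opResolventSet_subdifferential.2 hz⟩

variable {C : Set E} {F : E → E} {L : ℝ≥0} {η : ℝ}

theorem eg_estimates (hF : LipschitzWith L F) (hc : Convex ℝ C) (hcl : IsClosed C) (hη : 0 < η)
    {x zs : E}
    (hzs : zs ∈ opResolventSet (opSMul η (opAdd F (subdifferential (indicatorFn C)))) x) (z : E) :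
    let A := opSMul η (subdifferential (indicatorFn C))
    let B := fun z => z + η • F z - x
    let τ := 1 / (2 * (1 + η * L))
    ‖egStep τ A B z - zs‖ ^ 2 + 3 / 4 * ‖z - halfPoint τ A B z‖ ^ 2 +
        (1 - η * L) / (1 + η * L) * ‖halfPoint τ A B z - zs‖ ^ 2 ≤ ‖z - zs‖ ^ 2 ∧
      (1 - η * L) * ‖halfPoint τ A B z - zs‖ ≤ 3 * (1 + η * L) * ‖z - halfPoint τ A B z‖ := by
  intro A B τ
  rw [mem_opResolventSet_opAdd hη] at hzs
  have hLB : 0 < 1 + η * L := by positivity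
  have hproj := opResolvent_smul_subdifferential_spec ⟨zs, hzs.1⟩ hc hcl
    (τ := τ) (by positivity) hη
  have hh := hproj (z - τ • B z)
  have hz' := hproj (z - τ • B (halfPoint τ A B z))
  have hs : 0 ≤ inner ℝ (B zs) (halfPoint τ A B z - zs) := by
    have h := hzs.2 (halfPoint τ A B z) hh.1
    have e : x - η • F zs - zs = -(B zs) := by
      simp only [B]
      abel
    rw [e, inner_neg_left] at h
    linarith
  exact ⟨eg_step_norm_sq_le hLB (lipschitz_regularized hF hη x _ _)
      (strongly_monotone_regularized hF hη x _ _) (hh.2 _ hz'.1) (hz'.2 _ hzs.1) hs,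
    norm_half_sub_le hLB (lipschitz_regularized hF hη x _ _)
      (strongly_monotone_regularized hF hη x _ _) (hh.2 _ hzs.1) hs⟩

theorem norm_egIter_sub_le (hF : LipschitzWith L F) (hc : Convex ℝ C) (hcl : IsClosed C)
    (hη : 0 < η) (hηL : η * L < 1) {x zs : E}
    (hzs : zs ∈ opResolventSet (opSMul η (opAdd F (subdifferential (indicatorFn C)))) x) (t : ℕ) :
    ‖egIter x (opSMul η (subdifferential (indicatorFn C))) (fun z => z + η • F z) (1 + η * L) t
        - zs‖ ≤ Real.exp (-(t * (1 / (4 * kappa η L)))) * ‖x - zs‖ := by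
  have hL : 0 ≤ η * L := by positivity
  induction t with
  | zero => simp [egIter]
  | succ t ih =>
    have h := eg_step_contraction (p := (1 - η * L) / (1 + η * L))
      (div_pos (by linarith) (by linarith)) ((div_le_one (by linarith)).2 (by linarith))
      (eg_estimates hF hc hcl hη hzs (egIter x (opSMul η (subdifferential (indicatorFn C)))
        (fun z => z + η • F z) (1 + η * L) t)).1
    have hk : (1 - η * L) / (1 + η * L) / 4 = 1 / (4 * kappa η L) := by
      unfold kappa
      have : 1 - η * L ≠ 0 := by linarith
      field_simp
    rw [hk] at h
    have hs : egIter x (opSMul η (subdifferential (indicatorFn C))) (fun z => z + η • F z)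
        (1 + η * L) (t + 1) = egStep (1 / (2 * (1 + η * L)))
          (opSMul η (subdifferential (indicatorFn C))) (fun z => z + η • F z - x)
          (egIter x (opSMul η (subdifferential (indicatorFn C)))
            (fun z => z + η • F z) (1 + η * L) t) := Function.iterate_succ_apply' _ _ _
    rw [hs]
    refine h.trans ((mul_le_mul_of_nonneg_left ih (Real.exp_pos _).le).trans_eq ?_)
    rw [← mul_assoc, ← Real.exp_add]
    congr 2
    push_cast
    ring

/-- The relative accuracy guaranteed by `fbfSolver` at outer iteration `k`. -/
noncomputable def relTol (k : ℕ) : ℝ :=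
  1 / (8 * ((k : ℝ) + 1) * Real.log ((k : ℝ) + 2) ^ 2)

theorem relTol_pos (k : ℕ) : 0 < relTol k := by
  have : 0 < Real.log ((k : ℝ) + 2) := Real.log_pos (by linarith [k.cast_nonneg (α := ℝ)])
  unfold relTol
  positivity

theorem norm_fbfSolver_sub_le (hF : LipschitzWith L F) (hη : 0 < η) (hηL : η * L < 1) {x zs : E}
    (hzs : zs ∈ opResolventSet (opSMul η (opAdd F zeroOp)) x) (k : ℕ) :
    ‖(fbfSolver F zeroOp η L k x).1 - zs‖ ≤ relTol k * ‖x - zs‖ := by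
  have hκ := one_le_kappa hη hηL
  unfold fbfSolver
  rw [fbf_zeroOp]
  rw [zeroOp_eq_subdifferential] at hzs ⊢
  refine (norm_egIter_sub_le hF convex_univ isClosed_univ hη hηL hzs _).trans ?_
  gcongr
  have hX : 0 < 8 * ((k : ℝ) + 1) * Real.log ((k : ℝ) + 2) ^ 2 := one_div_pos.1 (relTol_pos k)
  -- `N_k` is at least `4κ log (1 / relTol k)`, which is what the rate `exp (-1/(4κ))` needs.
  have hr : relTol k = Real.exp (-Real.log (8 * ((k : ℝ) + 1) * Real.log ((k : ℝ) + 2) ^ 2)) := by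
    rw [Real.exp_neg, Real.exp_log hX, relTol, one_div]
  rw [hr, Real.exp_le_exp, neg_le_neg_iff, mul_one_div, le_div_iff₀ (by positivity)]
  refine le_trans (le_of_eq ?_) (Nat.le_ceil _)
  rw [kappa]
  ring

theorem norm_egSolve_sub_le (hF : LipschitzWith L F) (hc : Convex ℝ C) (hcl : IsClosed C)
    (hη : 0 < η) (hηL : η * L < 1) {x zs : E}
    (hzs : zs ∈ opResolventSet (opSMul η (opAdd F (subdifferential (indicatorFn C)))) x) {δ : ℝ}
    (htest : ∃ t, egStop x (opSMul η (subdifferential (indicatorFn C))) (fun z => z + η • F z)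
      (1 + η * L) (1 - η * L) δ t) :
    ‖(egSolve x (opSMul η (subdifferential (indicatorFn C))) (fun z => z + η • F z)
      (1 + η * L) (1 - η * L) δ).1 - zs‖ ≤ δ := by
  have h1 := Nat.sInf_mem (s := {t | egStop x (opSMul η (subdifferential (indicatorFn C)))
    (fun z => z + η • F z) (1 + η * L) (1 - η * L) δ t}) htest
  have h2 := (eg_estimates hF hc hcl hη hzs (egIter x (opSMul η (subdifferential (indicatorFn C)))
    (fun z => z + η • F z) (1 + η * L) (sInf {t | egStop x
      (opSMul η (subdifferential (indicatorFn C)))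
      (fun z => z + η • F z) (1 + η * L) (1 - η * L) δ t}))).2
  exact le_of_mul_le_mul_left (h2.trans h1) (by linarith)

/-- Since `‖z - h‖ ≤ 2‖z - zs‖` and `LB = μ κ`, the test holds once `6κ‖z - zs‖ ≤ δ`; linear
convergence achieves this in the stated time. -/
theorem egStop_of_le (hF : LipschitzWith L F) (hc : Convex ℝ C) (hcl : IsClosed C)
    (hη : 0 < η) (hηL : η * L < 1) {x zs : E}
    (hzs : zs ∈ opResolventSet (opSMul η (opAdd F (subdifferential (indicatorFn C)))) x) {δ : ℝ}
    (hδ : 0 < δ) {t : ℕ}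
    (ht : 4 * kappa η L * Real.log (6 * (1 + kappa η L * ‖x - zs‖ / δ)) ≤ t) :
    egStop x (opSMul η (subdifferential (indicatorFn C))) (fun z => z + η • F z)
      (1 + η * L) (1 - η * L) δ t := by
  have hκ := one_le_kappa hη hηL
  have hμ : 0 < 1 - η * (L : ℝ) := by linarith
  have hLB : 0 < 1 + η * (L : ℝ) := by positivity
  have h1 := (eg_estimates hF hc hcl hη hzs (egIter x (opSMul η (subdifferential (indicatorFn C)))
    (fun z => z + η • F z) (1 + η * L) t)).1
  have h2 := norm_egIter_sub_le hF hc hcl hη hηL hzs t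
  unfold egStop egHalf
  set z := egIter x (opSMul η (subdifferential (indicatorFn C)))
    (fun z => z + η • F z) (1 + η * L) t
  set h := halfPoint (1 / (2 * (1 + η * L))) (opSMul η (subdifferential (indicatorFn C)))
    (fun z => z + η • F z - x) z
  have h3 : ‖z - h‖ ≤ 2 * ‖z - zs‖ := by
    refine le_of_sq_le_sq ?_ (by positivity)
    have a1 : 0 ≤ (1 - η * L) / (1 + η * L) * ‖h - zs‖ ^ 2 := by positivity
    nlinarith [sq_nonneg ‖egStep (1 / (2 * (1 + η * L)))
      (opSMul η (subdifferential (indicatorFn C))) (fun z => z + η • F z - x) z - zs‖,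
      sq_nonneg ‖z - zs‖]
  have hY : 0 < 6 * (1 + kappa η L * ‖x - zs‖ / δ) := by positivity
  have h4 : Real.exp (-(t * (1 / (4 * kappa η L)))) ≤
      (6 * (1 + kappa η L * ‖x - zs‖ / δ))⁻¹ := by
    rw [← Real.exp_log (inv_pos.2 hY), Real.exp_le_exp, Real.log_inv, neg_le_neg_iff, mul_one_div,
      le_div_iff₀ (by positivity)]
    linarith
  have h5 : 6 * kappa η L * ‖z - zs‖ ≤ δ := by
    have a1 := mul_le_mul_of_nonneg_right h4 (norm_nonneg (x - zs))
    have a2 := mul_le_mul_of_nonneg_left (h2.trans a1) (by positivity : 0 ≤ 6 * kappa η L)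
    refine a2.trans ?_
    rw [inv_mul_eq_div, mul_div_assoc', div_le_iff₀ hY]
    have : δ * (6 * (1 + kappa η L * ‖x - zs‖ / δ)) = 6 * δ + 6 * kappa η L * ‖x - zs‖ := by
      field_simp
    rw [this]
    linarith
  have h6 : 1 + η * L = (1 - η * L) * kappa η L := by
    rw [kappa, mul_div_cancel₀ _ hμ.ne']
  calc 3 * (1 + η * L) * ‖z - h‖ ≤ 3 * (1 + η * L) * (2 * ‖z - zs‖) := by gcongr
    _ = (1 - η * L) * (6 * kappa η L * ‖z - zs‖) := by
      rw [h6]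
      ring
    _ ≤ _ := by gcongr

theorem egSolve_cost_le (hF : LipschitzWith L F) (hc : Convex ℝ C) (hcl : IsClosed C)
    (hη : 0 < η) (hηL : η * L < 1) {x zs : E}
    (hzs : zs ∈ opResolventSet (opSMul η (opAdd F (subdifferential (indicatorFn C)))) x) {δ : ℝ}
    (hδ : 0 < δ) :
    ((egSolve x (opSMul η (subdifferential (indicatorFn C))) (fun z => z + η • F z)
      (1 + η * L) (1 - η * L) δ).2 : ℝ) ≤
      20 * kappa η L * (1 + Real.log (1 + kappa η L * ‖x - zs‖ / δ)) := by
  have hκ := one_le_kappa hη hηL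
  set Y := 1 + kappa η L * ‖x - zs‖ / δ with hY
  have hY1 : 1 ≤ Y := by
    rw [hY]
    have : 0 ≤ kappa η L * ‖x - zs‖ / δ := by positivity
    linarith
  have h1 : sInf {t | egStop x (opSMul η (subdifferential (indicatorFn C)))
      (fun z => z + η • F z) (1 + η * L) (1 - η * L) δ t} ≤
      ⌈4 * kappa η L * Real.log (6 * Y)⌉₊ :=
    Nat.sInf_le (egStop_of_le hF hc hcl hη hηL hzs hδ (Nat.le_ceil _))
  have hl0 : 0 ≤ Real.log Y := Real.log_nonneg hY1
  have h2 := (Nat.ceil_lt_add_one (by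
    have := Real.log_nonneg (show 1 ≤ 6 * Y by linarith)
    positivity : 0 ≤ 4 * kappa η L * Real.log (6 * Y))).le
  have h3 := (Nat.cast_le (α := ℝ)).2 h1
  -- Hence `2T + 1 ≤ 8κ (2 + log Y) + 3`, and `κ ≥ 1` absorbs this into `20κ (1 + log Y)`.
  have h4 : Real.log 6 ≤ 2 := by
    rw [Real.log_le_iff_le_exp (by norm_num)]
    have := Real.exp_one_gt_d9
    have e : Real.exp 2 = Real.exp 1 * Real.exp 1 := by
      rw [← Real.exp_add]
      norm_num
    rw [e]
    nlinarith
  rw [Real.log_mul (by norm_num) (by linarith)] at h2 h3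
  unfold egSolve
  push_cast
  nlinarith [mul_le_mul_of_nonneg_left h4 (by linarith : 0 ≤ kappa η L),
    mul_nonneg (by linarith : 0 ≤ kappa η L) hl0]

end InnerSolvers

/-! ### Summability of the error tolerances. -/

section Summability

theorem sum_inv_mul_log_sq_le (n : ℕ) :
    ∑ k ∈ Finset.range n, 1 / (((k : ℝ) + 1) * Real.log ((k : ℝ) + 2) ^ 2) ≤ 6 := by
  -- Each term after the first is at most the increment of `-2 / log (k + 2)`, so the induction
  -- telescopes.
  have key : ∀ n : ℕ, ∑ k ∈ Finset.range (n + 1),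
      1 / (((k : ℝ) + 1) * Real.log ((k : ℝ) + 2) ^ 2) ≤ 6 - 2 / Real.log ((n : ℝ) + 2) := by
    intro n
    induction n with
    | zero =>
      have h2 := Real.log_two_gt_d9
      simp only [zero_add, Finset.range_one, Finset.sum_singleton, Nat.cast_zero, one_mul]
      rw [le_sub_iff_add_le, div_add_div _ _ (by positivity) (by positivity),
        div_le_iff₀ (by positivity)]
      have : 0 < Real.log 2 * (6 * Real.log 2 ^ 2 - 2 * Real.log 2 - 1) := by
        apply mul_pos (by linarith)
        nlinarith
      nlinarith
    | succ n ih =>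
      rw [Finset.sum_range_succ]
      have hn : (0 : ℝ) ≤ n := n.cast_nonneg
      have ha : 0 < Real.log ((n : ℝ) + 2) := Real.log_pos (by linarith)
      have hab : Real.log ((n : ℝ) + 2) ≤ Real.log ((n : ℝ) + 3) :=
        Real.log_le_log (by linarith) (by linarith)
      have hdiff : 1 / ((n : ℝ) + 3) ≤ Real.log ((n : ℝ) + 3) - Real.log ((n : ℝ) + 2) := by
        have h := Real.one_sub_inv_le_log_of_pos
          (show 0 < ((n : ℝ) + 3) / ((n : ℝ) + 2) by positivity)
        rw [Real.log_div (by positivity) (by positivity)] at h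
        refine le_trans (le_of_eq ?_) h
        field_simp
        ring
      have e : ((n + 1 : ℕ) : ℝ) + 2 = n + 3 := by
        push_cast
        ring
      rw [e]
      push_cast
      set a := Real.log ((n : ℝ) + 2)
      set b := Real.log ((n : ℝ) + 3)
      have hb : 0 < b := ha.trans_le hab
      have h1 : 1 / (((n : ℝ) + 1 + 1) * b ^ 2) ≤ 2 / a - 2 / b := by
        have a1 : 2 / a - 2 / b = 2 * (b - a) / (a * b) := by
          field_simp
        rw [a1, div_le_div_iff₀ (by positivity) (by positivity)]
        rw [div_le_iff₀ (by positivity)] at hdiff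
        have a2 : 1 ≤ 2 * (b - a) * ((n : ℝ) + 1 + 1) := by nlinarith
        have a3 : a * b ≤ b ^ 2 := by nlinarith
        have a4 := mul_le_mul_of_nonneg_right a2 (sq_nonneg b)
        linarith
      linarith
  rcases n with _ | n
  · simp
  · have : 0 < Real.log ((n : ℝ) + 2) := Real.log_pos (by linarith [n.cast_nonneg (α := ℝ)])
    have h := key n
    have : 0 < 2 / Real.log ((n : ℝ) + 2) := by positivity
    linarith

theorem sum_relTol_le (n : ℕ) : ∑ k ∈ Finset.range n, relTol k ≤ 3 / 4 := by
  have e : ∀ k : ℕ, relTol k = 1 / 8 * (1 / (((k : ℝ) + 1) * Real.log ((k : ℝ) + 2) ^ 2)) := by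
    intro k
    rw [relTol, mul_assoc, one_div_mul_one_div]
  simp_rw [e]
  rw [← Finset.mul_sum]
  linarith [sum_inv_mul_log_sq_le n]

/-- The shift `k + 3` in `tol` exceeds `e` already at `k = 0`, so every tolerance is at most `η ε²`.
-/
theorem log_add_three_gt_one (k : ℕ) : 1 < Real.log ((k : ℝ) + 3) := by
  rw [Real.lt_log_iff_exp_lt (by positivity)]
  linarith [Real.exp_one_lt_d9, k.cast_nonneg (α := ℝ)]

theorem tol_pos {η ε : ℝ} (hη : 0 < η) (hε : 0 < ε) (k : ℕ) : 0 < tol η ε k := by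
  have := log_add_three_gt_one k
  unfold tol
  positivity

theorem tol_le {η ε : ℝ} (hη : 0 < η) (k : ℕ) : tol η ε k ≤ η * ε ^ 2 := by
  have := log_add_three_gt_one k
  unfold tol
  apply div_le_self (by positivity)
  have h1 : (1 : ℝ) ≤ k + 1 := by linarith [k.cast_nonneg (α := ℝ)]
  have h2 : 1 ≤ Real.log ((k : ℝ) + 3) ^ 2 := by nlinarith
  nlinarith

theorem sum_tol_le {η ε : ℝ} (hη : 0 < η) (n : ℕ) :
    ∑ k ∈ Finset.range n, tol η ε k ≤ 6 * (η * ε ^ 2) := by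
  have e : ∀ k ∈ Finset.range n, tol η ε k ≤
      η * ε ^ 2 * (1 / (((k : ℝ) + 1) * Real.log ((k : ℝ) + 2) ^ 2)) := by
    intro k _
    have hk : (0 : ℝ) ≤ k := k.cast_nonneg
    have : 0 < Real.log ((k : ℝ) + 2) := Real.log_pos (by linarith)
    rw [tol, mul_one_div]
    gcongr
    norm_num
  refine (Finset.sum_le_sum e).trans ?_
  rw [← Finset.mul_sum]
  have := mul_le_mul_of_nonneg_left (sum_inv_mul_log_sq_le n) (by positivity : 0 ≤ η * ε ^ 2)
  linarith

end Summability

/-! ### From energy estimates to residual bounds and oracle counts. -/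

section Complexity

theorem km_snd_eq_sum {E : Type*} [AddCommGroup E] [Module ℝ E] (S : InnerSolver E) (α : ℝ)
    (x₀ : E) (n : ℕ) :
    (km S α x₀ n).2 = ∑ k ∈ Finset.range n, (S k (km S α x₀ k).1).2 := by
  induction n with
  | zero => rfl
  | succ n ih =>
    rw [Finset.sum_range_succ, ← ih]
    rfl

theorem km_snd_le {E : Type*} [AddCommGroup E] [Module ℝ E] {S : InnerSolver E} {α : ℝ}
    {x₀ : E} {n : ℕ} {c : ℝ} (h : ∀ k < n, ((S k (km S α x₀ k).1).2 : ℝ) ≤ c) :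
    ((km S α x₀ n).2 : ℝ) ≤ n * c := by
  rw [km_snd_eq_sum, Nat.cast_sum]
  refine (Finset.sum_le_sum fun k hk => h k (Finset.mem_range.1 hk)).trans_eq ?_
  simp

theorem exists_sq_le_of_sum_le {r : ℕ → ℝ} {n : ℕ} {c : ℝ} (hn : 0 < n)
    (h : ∑ k ∈ Finset.range n, r k ^ 2 ≤ n * c ^ 2) (hc : 0 ≤ c) : ∃ k < n, r k ≤ c := by
  by_contra! hlt
  have : ∑ _k ∈ Finset.range n, c ^ 2 < ∑ k ∈ Finset.range n, r k ^ 2 := by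
    refine Finset.sum_lt_sum_of_nonempty (Finset.nonempty_range_iff.2 hn.ne') fun k hk => ?_
    have := hlt k (Finset.mem_range.1 hk)
    gcongr
  simp only [Finset.sum_const, Finset.card_range, nsmul_eq_mul] at this
  linarith

theorem one_le_outerOrder (η ρ ε D : ℝ) : 1 ≤ outerOrder η ρ ε D := le_max_left _ _

theorem sq_le_outerOrder_mul {η ρ ε : ℝ} (hρη : ρ < η) (hε : 0 < ε) (D : ℝ) :
    D ^ 2 ≤ outerOrder η ρ ε D * ((η - ρ) * ε) ^ 2 := by
  have h : D ^ 2 / ((η - ρ) ^ 2 * ε ^ 2) ≤ outerOrder η ρ ε D := le_max_right _ _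
  have : 0 < η - ρ := by linarith
  rw [div_le_iff₀ (by positivity)] at h
  rwa [mul_pow]

theorem ceil_mul_outerOrder_bounds {M : ℝ} (hM : 1 ≤ M) (n : ℕ) :
    n * M ≤ ⌈n * M⌉₊ ∧ (⌈n * M⌉₊ : ℝ) ≤ (n + 1) * M := by
  refine ⟨Nat.le_ceil _, ?_⟩
  have := (Nat.ceil_lt_add_one (by positivity : 0 ≤ n * M)).le
  linarith

variable {E : Type*} [NormedAddCommGroup E] [InnerProductSpace ℝ E]

theorem relative_error_exists_residual_le {S : InnerSolver E} {J : E → E} {ρ η ε : ℝ} {x₀ xs : E}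
    (hρ : 0 < ρ) (hρη : ρ < η) (hε : 0 < ε)
    (hJ : ∀ x, (1 - ρ / η) * ‖x - J x‖ ^ 2 ≤ inner ℝ (x - J x) (x - xs))
    (hS : ∀ k x, ‖(S k x).1 - J x‖ ≤ relTol k * ‖x - J x‖) {n : ℕ}
    (hn : 9 * outerOrder η ρ ε ‖x₀ - xs‖ ≤ n) :
    ∃ k < n, ‖(km S (1 - ρ / η) x₀ k).1 - J (km S (1 - ρ / η) x₀ k).1‖ ≤ η * ε := by
  have hη : 0 < η := hρ.trans hρη
  have hα : 0 < 1 - ρ / η := by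
    rw [sub_pos, div_lt_one hη]
    exact hρη
  have hM := one_le_outerOrder η ρ ε ‖x₀ - xs‖
  have hD := sq_le_outerOrder_mul hρη hε ‖x₀ - xs‖
  have h1 := km_energy_le_of_relative_error hα.le hJ (fun k => (relTol_pos k).le) hS n (x₀ := x₀)
  -- The relative errors sum to at most `3/4`, and `e² ≤ 9`; this is the 9 in the number of outer
  -- iterations.
  have h2 : Real.exp (2 * ∑ k ∈ Finset.range n, relTol k) ≤ 9 := by
    have a1 : Real.exp (2 * ∑ k ∈ Finset.range n, relTol k) ≤ Real.exp (2 * 1) := by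
      rw [Real.exp_le_exp]
      linarith [sum_relTol_le n]
    refine a1.trans ?_
    rw [two_mul, Real.exp_add]
    nlinarith [Real.exp_one_lt_d9, Real.exp_pos 1]
  have hn0 : (0 : ℝ) < n := by linarith
  refine exists_sq_le_of_sum_le (by exact_mod_cast hn0) ?_ (by positivity)
  have e : (1 - ρ / η) * η = η - ρ := by field_simp
  have h3 := mul_le_mul_of_nonneg_right h2 (sq_nonneg ‖x₀ - xs‖)
  have h4 := mul_le_mul_of_nonneg_right hn (sq_nonneg ((η - ρ) * ε))
  refine le_of_mul_le_mul_left ?_ (pow_pos hα 2)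
  have e2 : (1 - ρ / η) ^ 2 * (n * (η * ε) ^ 2) = n * ((η - ρ) * ε) ^ 2 := by
    rw [← e]
    ring
  rw [e2]
  nlinarith [sq_nonneg ‖(km S (1 - ρ / η) x₀ n).1 - xs‖]

section AbsoluteError

variable {S : InnerSolver E} {J : E → E} {ρ η ε : ℝ} {x₀ xs : E}

theorem absolute_error_energy_le (hρ : 0 < ρ) (hρη : ρ < η) (hε : 0 < ε)
    (hJ : ∀ x, (1 - ρ / η) * ‖x - J x‖ ^ 2 ≤ inner ℝ (x - J x) (x - xs))
    (hS : ∀ k, ‖(S k (km S (1 - ρ / η) x₀ k).1).1 - J (km S (1 - ρ / η) x₀ k).1‖ ≤ tol η ε k)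
    (n : ℕ) :
    ‖(km S (1 - ρ / η) x₀ n).1 - xs‖ ^ 2 + (1 - ρ / η) ^ 2 * ∑ k ∈ Finset.range n,
        ‖(km S (1 - ρ / η) x₀ k).1 - J (km S (1 - ρ / η) x₀ k).1‖ ^ 2 ≤
      ((1 - ρ / η) * (η * (ε * √(outerOrder η ρ ε ‖x₀ - xs‖) + 6 * ε ^ 2))) ^ 2 := by
  have hη : 0 < η := hρ.trans hρη
  have hα : 0 < 1 - ρ / η := by
    rw [sub_pos, div_lt_one hη]
    exact hρη
  have hM := one_le_outerOrder η ρ ε ‖x₀ - xs‖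
  have hD : ‖x₀ - xs‖ ≤ (1 - ρ / η) * (η * (ε * √(outerOrder η ρ ε ‖x₀ - xs‖))) := by
    refine le_of_sq_le_sq ?_ (by positivity)
    refine (sq_le_outerOrder_mul hρη hε ‖x₀ - xs‖).trans_eq ?_
    have e : η - ρ = (1 - ρ / η) * η := by field_simp
    rw [e, mul_pow, mul_pow, mul_pow, mul_pow, mul_pow, Real.sq_sqrt (by linarith)]
    ring
  refine (km_energy_le hα.le hJ hS n).trans ?_
  have h1 := mul_le_mul_of_nonneg_left (sum_tol_le (ε := ε) hη n) hα.le
  have h2 : 0 ≤ ∑ k ∈ Finset.range n, tol η ε k :=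
    Finset.sum_nonneg fun k _ => (tol_pos hη hε k).le
  refine pow_le_pow_left₀ (by positivity) ?_ 2
  linarith

theorem absolute_error_residual_le (hρ : 0 < ρ) (hρη : ρ < η) (hε : 0 < ε)
    (hJ : ∀ x, (1 - ρ / η) * ‖x - J x‖ ^ 2 ≤ inner ℝ (x - J x) (x - xs))
    (hS : ∀ k, ‖(S k (km S (1 - ρ / η) x₀ k).1).1 - J (km S (1 - ρ / η) x₀ k).1‖ ≤ tol η ε k)
    (n : ℕ) :
    ‖(km S (1 - ρ / η) x₀ n).1 - J (km S (1 - ρ / η) x₀ n).1‖ ≤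
      η * (ε * √(outerOrder η ρ ε ‖x₀ - xs‖) + 6 * ε ^ 2) := by
  have hη : 0 < η := hρ.trans hρη
  have hα : 0 < 1 - ρ / η := by
    rw [sub_pos, div_lt_one hη]
    exact hρη
  have h := absolute_error_energy_le hρ hρη hε hJ hS n
  refine le_of_mul_le_mul_left ((mul_norm_sub_le_of_inner_ge (hJ _)).trans ?_) hα
  refine le_of_sq_le_sq (le_trans ?_ h) (by positivity)
  have : 0 ≤ (1 - ρ / η) ^ 2 * ∑ k ∈ Finset.range n,
      ‖(km S (1 - ρ / η) x₀ k).1 - J (km S (1 - ρ / η) x₀ k).1‖ ^ 2 := by positivity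
  linarith

theorem absolute_error_exists_residual_le (hρ : 0 < ρ) (hρη : ρ < η) (hε : 0 < ε)
    (hJ : ∀ x, (1 - ρ / η) * ‖x - J x‖ ^ 2 ≤ inner ℝ (x - J x) (x - xs))
    (hS : ∀ k, ‖(S k (km S (1 - ρ / η) x₀ k).1).1 - J (km S (1 - ρ / η) x₀ k).1‖ ≤ tol η ε k)
    {n : ℕ} (hn : 36 * outerOrder η ρ ε ‖x₀ - xs‖ ≤ n) :
    ∃ k < n, ‖(km S (1 - ρ / η) x₀ k).1 - J (km S (1 - ρ / η) x₀ k).1‖ ≤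
      η * (ε + ε ^ 2) := by
  have hη : 0 < η := hρ.trans hρη
  have hα : 0 < 1 - ρ / η := by
    rw [sub_pos, div_lt_one hη]
    exact hρη
  have hM := one_le_outerOrder η ρ ε ‖x₀ - xs‖
  have h := absolute_error_energy_le hρ hρη hε hJ hS n
  have hn0 : (0 : ℝ) < n := by linarith
  refine exists_sq_le_of_sum_le (by exact_mod_cast hn0) ?_ (by positivity)
  -- Squaring the right-hand side yields the factor `36 M` required of `n`.
  have h1 : ε * √(outerOrder η ρ ε ‖x₀ - xs‖) + 6 * ε ^ 2 ≤
      6 * √(outerOrder η ρ ε ‖x₀ - xs‖) * (ε + ε ^ 2) := by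
    have hs : 1 ≤ √(outerOrder η ρ ε ‖x₀ - xs‖) := Real.one_le_sqrt.2 hM
    nlinarith [mul_nonneg (sub_nonneg.2 hs) (sq_nonneg ε), mul_pos hε (by linarith :
      0 < √(outerOrder η ρ ε ‖x₀ - xs‖))]
  have h2 : (η * (ε * √(outerOrder η ρ ε ‖x₀ - xs‖) + 6 * ε ^ 2)) ^ 2 ≤
      n * (η * (ε + ε ^ 2)) ^ 2 := by
    calc _ ≤ (η * (6 * √(outerOrder η ρ ε ‖x₀ - xs‖) * (ε + ε ^ 2))) ^ 2 := by gcongr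
      _ = 36 * √(outerOrder η ρ ε ‖x₀ - xs‖) ^ 2 * (η * (ε + ε ^ 2)) ^ 2 := by ring
      _ ≤ _ := by
        rw [Real.sq_sqrt (by linarith)]
        gcongr
  rw [mul_pow] at h
  refine le_of_mul_le_mul_left (le_trans ?_
    (h.trans (mul_le_mul_of_nonneg_left h2 (sq_nonneg _)))) (pow_pos hα 2)
  linarith [sq_nonneg ‖(km S (1 - ρ / η) x₀ n).1 - xs‖]

/-- The computable residual differs from the true one by at most `η ε²`. Comparing `m` with an
iterate of residual `η(ε + ε²)` pays this twice. -/
theorem best_iterate_residual_le (hρ : 0 < ρ) (hρη : ρ < η) (hε : 0 < ε)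
    (hJ : ∀ x, (1 - ρ / η) * ‖x - J x‖ ^ 2 ≤ inner ℝ (x - J x) (x - xs))
    (hS : ∀ k, ‖(S k (km S (1 - ρ / η) x₀ k).1).1 - J (km S (1 - ρ / η) x₀ k).1‖ ≤ tol η ε k)
    {n m : ℕ} (hn : 36 * outerOrder η ρ ε ‖x₀ - xs‖ ≤ n)
    (hm : IsBestIterate S (1 - ρ / η) x₀ n m) :
    η⁻¹ * ‖(km S (1 - ρ / η) x₀ m).1 - J (km S (1 - ρ / η) x₀ m).1‖ ≤ 2 * ε + 3 * ε ^ 2 := by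
  have hη : 0 < η := hρ.trans hρη
  obtain ⟨k, hk, hr⟩ := absolute_error_exists_residual_le hρ hρη hε hJ hS hn
  have h1 := hm.2 k hk
  set x := (km S (1 - ρ / η) x₀ m).1
  set y := (km S (1 - ρ / η) x₀ k).1
  have h2 : ‖x - J x‖ ≤ ‖x - (S m x).1‖ + ‖(S m x).1 - J x‖ :=
    norm_sub_le_norm_sub_add_norm_sub _ _ _
  have h3 : ‖y - (S k y).1‖ ≤ ‖y - J y‖ + ‖(S k y).1 - J y‖ := by
    rw [norm_sub_rev (S k y).1]
    exact norm_sub_le_norm_sub_add_norm_sub _ _ _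
  have h4 := (hS k).trans (tol_le hη k)
  have h5 := (hS m).trans (tol_le hη m)
  rw [inv_mul_le_iff₀ hη]
  nlinarith [mul_pos hη hε]

theorem absolute_error_log_le (hρ : 0 < ρ) (hρη : ρ < η) (hε : 0 < ε)
    (hJ : ∀ x, (1 - ρ / η) * ‖x - J x‖ ^ 2 ≤ inner ℝ (x - J x) (x - xs))
    (hS : ∀ k, ‖(S k (km S (1 - ρ / η) x₀ k).1).1 - J (km S (1 - ρ / η) x₀ k).1‖ ≤ tol η ε k)
    {κ : ℝ} (hκ : 1 ≤ κ) {n k : ℕ} (hn : (n : ℝ) ≤ 37 * outerOrder η ρ ε ‖x₀ - xs‖) (hk : k < n) :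
    Real.log (1 + κ * ‖(km S (1 - ρ / η) x₀ k).1 - J (km S (1 - ρ / η) x₀ k).1‖ / tol η ε k) ≤
      121 + 4 * Real.log (κ * outerOrder η ρ ε ‖x₀ - xs‖ * max 1 ε⁻¹) := by
  have hη : 0 < η := hρ.trans hρη
  have hM := one_le_outerOrder η ρ ε ‖x₀ - xs‖
  have hr := absolute_error_residual_le hρ hρη hε hJ hS k
  set r := ‖(km S (1 - ρ / η) x₀ k).1 - J (km S (1 - ρ / η) x₀ k).1‖
  set M := outerOrder η ρ ε ‖x₀ - xs‖
  have hm : 1 ≤ max 1 ε⁻¹ := le_max_left _ _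
  have hm2 : 1 ≤ max 1 ε⁻¹ * ε := by
    have := mul_le_mul_of_nonneg_right (le_max_right 1 ε⁻¹) hε.le
    rwa [inv_mul_cancel₀ hε.ne'] at this
  set m := max 1 ε⁻¹
  set X := κ * M * m with hX
  have hMX : M ≤ X := by
    calc M = 1 * M * 1 := by ring
      _ ≤ κ * M * m := by gcongr
  have hX1 : 1 ≤ X := hM.trans hMX
  have hk0 : (0 : ℝ) ≤ k := k.cast_nonneg
  have hkn : (k : ℝ) + 1 ≤ n := by exact_mod_cast hk
  have hlog := log_add_three_gt_one k
  have hlog2 : Real.log ((k : ℝ) + 3) ≤ k + 3 := Real.log_le_self (by linarith)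
  have hs : √M ≤ M := by
    rw [Real.sqrt_le_left (by linarith)]
    nlinarith
  -- `m * ε ≥ 1` turns `ε √M` into a multiple of `ε²`, and `k + 3 ≤ 37 M + 2 ≤ 39 X` bounds each of
  -- the three factors of the tolerance's denominator.
  have h1 : r / tol η ε k ≤ 7 * (M * m) * (39 * X) ^ 3 := by
    rw [div_le_iff₀ (tol_pos hη hε k), tol, mul_div_assoc', le_div_iff₀ (by positivity)]
    have h3 : ε * √M + 6 * ε ^ 2 ≤ 7 * (M * m) * ε ^ 2 := by
      have a1 : ε * √M ≤ M * m * ε ^ 2 := by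
        calc ε * √M ≤ ε * M * 1 := by
              rw [mul_one]
              gcongr
          _ ≤ ε * M * (m * ε) := by gcongr
          _ = _ := by ring
      have a2 : 1 * ε ^ 2 ≤ M * m * ε ^ 2 := by
        gcongr
        nlinarith
      linarith
    have h4 : ((k : ℝ) + 1) * Real.log ((k : ℝ) + 3) ^ 2 ≤ (39 * X) ^ 3 := by
      calc ((k : ℝ) + 1) * Real.log ((k : ℝ) + 3) ^ 2 ≤ (39 * X) * (39 * X) ^ 2 := by
            gcongr
            · linarith
            · linarith
        _ = _ := by ring
    calc _ ≤ η * (7 * (M * m) * ε ^ 2) * (39 * X) ^ 3 := by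
          gcongr
          exact hr.trans (by gcongr)
      _ = _ := by ring
  have h2 : 1 + κ * r / tol η ε k ≤ 8 * 39 ^ 3 * X ^ 4 := by
    have a1 := mul_le_mul_of_nonneg_left h1 (by linarith : 0 ≤ κ)
    have a2 : κ * (7 * (M * m) * (39 * X) ^ 3) = 7 * 39 ^ 3 * X ^ 4 := by
      rw [hX]
      ring
    have a3 : 1 ≤ X ^ 4 := one_le_pow₀ hX1
    rw [mul_div_assoc]
    linarith
  have hpos : 0 < 1 + κ * r / tol η ε k := by
    have := tol_pos hη hε k
    positivity
  have h3 := Real.log_le_log hpos h2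
  rw [Real.log_mul (by norm_num) (by positivity), Real.log_mul (by norm_num) (by norm_num),
    Real.log_pow, Real.log_pow] at h3
  have h4 := Real.log_le_sub_one_of_pos (show (0 : ℝ) < 8 by norm_num)
  have h5 := Real.log_le_sub_one_of_pos (show (0 : ℝ) < 39 by norm_num)
  push_cast at h3
  linarith

theorem absolute_error_cost_le (hρ : 0 < ρ) (hρη : ρ < η) (hε : 0 < ε)
    (hJ : ∀ x, (1 - ρ / η) * ‖x - J x‖ ^ 2 ≤ inner ℝ (x - J x) (x - xs))
    (hS : ∀ k, ‖(S k (km S (1 - ρ / η) x₀ k).1).1 - J (km S (1 - ρ / η) x₀ k).1‖ ≤ tol η ε k)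
    {κ b : ℝ} (hκ : 1 ≤ κ) (hb : 0 ≤ b)
    (hcost : ∀ k, ((S k (km S (1 - ρ / η) x₀ k).1).2 : ℝ) ≤ b * κ * (1 + Real.log (1 +
      κ * ‖(km S (1 - ρ / η) x₀ k).1 - J (km S (1 - ρ / η) x₀ k).1‖ / tol η ε k)))
    {n : ℕ} (hn : (n : ℝ) ≤ 37 * outerOrder η ρ ε ‖x₀ - xs‖) :
    ((km S (1 - ρ / η) x₀ n).2 : ℝ) ≤ 5000 * b * κ * outerOrder η ρ ε ‖x₀ - xs‖ *
      (1 + Real.log (κ * outerOrder η ρ ε ‖x₀ - xs‖ * max 1 ε⁻¹)) := by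
  have hM := one_le_outerOrder η ρ ε ‖x₀ - xs‖
  have hlog : 0 ≤ Real.log (κ * outerOrder η ρ ε ‖x₀ - xs‖ * max 1 ε⁻¹) := by
    apply Real.log_nonneg
    have : 1 ≤ max 1 ε⁻¹ := le_max_left _ _
    calc (1 : ℝ) = 1 * 1 * 1 := by ring
      _ ≤ _ := by gcongr
  set l := Real.log (κ * outerOrder η ρ ε ‖x₀ - xs‖ * max 1 ε⁻¹)
  refine (km_snd_le (c := b * κ * (122 * (1 + l))) fun k hk => (hcost k).trans ?_).trans ?_
  · have := absolute_error_log_le hρ hρη hε hJ hS hκ hn hk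
    gcongr
    linarith
  · calc _ ≤ 37 * outerOrder η ρ ε ‖x₀ - xs‖ * (b * κ * (122 * (1 + l))) := by gcongr
      _ = 4514 * (b * κ * outerOrder η ρ ε ‖x₀ - xs‖ * (1 + l)) := by ring
      _ ≤ 5000 * (b * κ * outerOrder η ρ ε ‖x₀ - xs‖ * (1 + l)) := by
        gcongr
        norm_num
      _ = _ := by ring

end AbsoluteError

theorem fbfSolver_total_cost_le {F : E → E} {L : ℝ≥0} {η : ℝ} (hη : 0 < η) (hηL : η * L < 1)
    {α : ℝ} {x₀ : E} {M : ℝ} (hM : 1 ≤ M) {n : ℕ} (hn : (n : ℝ) ≤ 10 * M) :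
    ((km (fbfSolver F zeroOp η L) α x₀ n).2 : ℝ) ≤
      4000 * kappa η L * M * (1 + Real.log M) := by
  have hκ := one_le_kappa hη hηL
  have hlog := Real.log_nonneg hM
  refine (km_snd_le (c := kappa η L * (322 * (1 + Real.log M))) fun k hk =>
    (fbfSolver_cost_le hη hηL k _).trans ?_).trans ?_
  · gcongr
    have hkn : (k : ℝ) + 1 ≤ n := by exact_mod_cast hk
    have h1 : Real.log ((k : ℝ) + 2) ≤ Real.log (12 * M) :=
      Real.log_le_log (by positivity) (by linarith)
    rw [Real.log_mul (by norm_num) (by linarith)] at h1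
    have h4 := Real.log_le_sub_one_of_pos (show (0 : ℝ) < 8 by norm_num)
    have h5 := Real.log_le_sub_one_of_pos (show (0 : ℝ) < 12 by norm_num)
    linarith
  · calc _ ≤ 10 * M * (kappa η L * (322 * (1 + Real.log M))) := by gcongr
      _ = 3220 * (kappa η L * M * (1 + Real.log M)) := by ring
      _ ≤ 4000 * (kappa η L * M * (1 + Real.log M)) := by
        gcongr
        norm_num
      _ = _ := by ring

/-- For `G ≡ 0` the residual is `η F z`, so `‖F z‖ ≤ ε`; returning from `z` to `x` costs at most `L
η ε ≤ ε`. -/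
theorem norm_le_of_residual_le {F : E → E} {L : ℝ≥0} {η ε : ℝ} (hF : LipschitzWith L F)
    (hη : 0 < η) (hηL : η * L < 1) {x z : E} (hz : z ∈ opResolventSet (opSMul η (opAdd F zeroOp)) x)
    (h : ‖x - z‖ ≤ η * ε) : ‖F x‖ ≤ 2 * ε := by
  obtain ⟨_, ⟨_, ⟨_, rfl, rfl⟩, rfl⟩, hx⟩ := hz
  have e : x - z = η • F z := by
    rw [hx]
    simp
  have h1 : η * ‖F z‖ ≤ η * ε := by
    rwa [e, norm_smul, Real.norm_eq_abs, abs_of_pos hη] at h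
  have h2 := le_of_mul_le_mul_left h1 hη
  have h3 := (hF.norm_sub_le x z).trans (mul_le_mul_of_nonneg_left h L.2)
  have h4 : ‖F x‖ ≤ ‖F x - F z‖ + ‖F z‖ := by
    simpa using norm_add_le (F x - F z) (F z)
  have hε : 0 ≤ ε := (norm_nonneg _).trans h2
  have h5 := mul_le_mul_of_nonneg_right hηL.le hε
  have h6 : ‖F x - F z‖ ≤ η * L * ε := by
    refine h3.trans_eq ?_
    ring
  linarith

end Complexity

end WeakMVI

/-! ### Assembly of both parts. -/

theorem corollaryB7 :
    -- (i) `G ≡ 0`, the FBF inner solver with prescribed iteration numbers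
    (∃ c : ℝ, 0 < c ∧
      ∀ (d : ℕ) (F : EuclideanSpace ℝ (Fin d) → EuclideanSpace ℝ (Fin d)) (L : ℝ≥0) (ρ η : ℝ)
        (x₀ xs : EuclideanSpace ℝ (Fin d)),
        LipschitzWith L F → 0 < ρ → ρ < η → η * L < 1 →
        WeakMVI.IsWeakMVISolution (WeakMVI.opAdd F WeakMVI.zeroOp) ρ xs →
        ∀ ε : ℝ, 0 < ε →
        ∃ K : ℕ, 1 ≤ K ∧ (K : ℝ) ≤ c * WeakMVI.outerOrder η ρ ε ‖x₀ - xs‖ ∧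
          (∃ k < K,
            ‖F (WeakMVI.km (WeakMVI.fbfSolver F WeakMVI.zeroOp η L) (1 - ρ / η) x₀ k).1‖
              ≤ 2 * ε) ∧
          ((WeakMVI.km (WeakMVI.fbfSolver F WeakMVI.zeroOp η L) (1 - ρ / η) x₀ K).2 : ℝ)
            ≤ c * WeakMVI.kappa η L * WeakMVI.outerOrder η ρ ε ‖x₀ - xs‖ *
              (1 + Real.log (WeakMVI.outerOrder η ρ ε ‖x₀ - xs‖))) ∧
    -- (ii) `G = ∂ι_C`, inner solvers with accuracy `η ε² / ((k + 1) log² (k + 3))`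
    (∃ c : ℝ, 0 < c ∧
      ∀ (d : ℕ) (F : EuclideanSpace ℝ (Fin d) → EuclideanSpace ℝ (Fin d))
        (C : Set (EuclideanSpace ℝ (Fin d))) (G : EuclideanSpace ℝ (Fin d) →
          Set (EuclideanSpace ℝ (Fin d))) (L : ℝ≥0) (ρ η : ℝ)
        (x₀ xs : EuclideanSpace ℝ (Fin d)),
        LipschitzWith L F → Convex ℝ C → IsClosed C →
        G = WeakMVI.subdifferential (WeakMVI.indicatorFn C) →
        0 < ρ → ρ < η → η * L < 1 →
        WeakMVI.IsWeakMVISolution (WeakMVI.opAdd F G) ρ xs →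
        -- the resolvent is single-valued with full domain
        (∀ x, WeakMVI.opResolventSet (WeakMVI.opSMul η (WeakMVI.opAdd F G)) x =
          {WeakMVI.opResolvent (WeakMVI.opSMul η (WeakMVI.opAdd F G)) x}) ∧
        ∀ ε : ℝ, 0 < ε →
        -- the stopping test of the extragradient solver is met at every outer iteration, and its
        -- output satisfies the error criterion
        (∀ k : ℕ, ∃ t : ℕ, WeakMVI.egStop
          (WeakMVI.km (WeakMVI.egSolver F G η L ε) (1 - ρ / η) x₀ k).1
          (WeakMVI.opSMul η G) (fun z => z + η • F z) (1 + η * L) (1 - η * L)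
          (WeakMVI.tol η ε k) t) ∧
        WeakMVI.MeetsTol F G η ε (WeakMVI.egSolver F G η L ε) (1 - ρ / η) x₀ ∧
        ∃ K : ℕ, 1 ≤ K ∧ (K : ℝ) ≤ c * WeakMVI.outerOrder η ρ ε ‖x₀ - xs‖ ∧
          -- total number of oracle calls with the extragradient solver
          ((WeakMVI.km (WeakMVI.egSolver F G η L ε) (1 - ρ / η) x₀ K).2 : ℝ)
            ≤ c * WeakMVI.kappa η L * WeakMVI.outerOrder η ρ ε ‖x₀ - xs‖ *
              (1 + Real.log (WeakMVI.kappa η L * WeakMVI.outerOrder η ρ ε ‖x₀ - xs‖ *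
                max 1 ε⁻¹)) ∧
          -- the guarantee and the total cost, for every inner solver that satisfies the error
          -- criterion (in particular for the extragradient solver)
          ∀ S : WeakMVI.InnerSolver (EuclideanSpace ℝ (Fin d)),
            WeakMVI.MeetsTol F G η ε S (1 - ρ / η) x₀ →
            (∀ K' ≥ K, ∀ m : ℕ, WeakMVI.IsBestIterate S (1 - ρ / η) x₀ K' m →
              η⁻¹ * ‖(WeakMVI.km S (1 - ρ / η) x₀ m).1 -
                  WeakMVI.opResolvent (WeakMVI.opSMul η (WeakMVI.opAdd F G))
                    (WeakMVI.km S (1 - ρ / η) x₀ m).1‖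
                ≤ 2 * ε + 3 * ε ^ 2) ∧
            ∀ b : ℝ, 0 ≤ b →
              (∀ k : ℕ, ((S k (WeakMVI.km S (1 - ρ / η) x₀ k).1).2 : ℝ) ≤
                b * WeakMVI.kappa η L * (1 + Real.log (1 + WeakMVI.kappa η L *
                  ‖(WeakMVI.km S (1 - ρ / η) x₀ k).1 -
                    WeakMVI.opResolvent (WeakMVI.opSMul η (WeakMVI.opAdd F G))
                      (WeakMVI.km S (1 - ρ / η) x₀ k).1‖ / WeakMVI.tol η ε k))) →
              ((WeakMVI.km S (1 - ρ / η) x₀ K).2 : ℝ)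
                ≤ c * b * WeakMVI.kappa η L * WeakMVI.outerOrder η ρ ε ‖x₀ - xs‖ *
                  (1 + Real.log (WeakMVI.kappa η L * WeakMVI.outerOrder η ρ ε ‖x₀ - xs‖ *
                    max 1 ε⁻¹))) := by
  -- In (ii), `100000 = 5000 * 20`: the constant of `absolute_error_cost_le` times the `b = 20` of
  -- the extragradient solver.
  refine ⟨⟨4000, by norm_num, ?_⟩, ⟨100000, by norm_num, ?_⟩⟩
  · intro d F L ρ η x₀ xs hF hρ hρη hηL hxs ε hε
    have hη : 0 < η := hρ.trans hρη
    have hJ : ∀ x, WeakMVI.opResolvent (WeakMVI.opSMul η (WeakMVI.opAdd F WeakMVI.zeroOp)) x ∈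
        WeakMVI.opResolventSet (WeakMVI.opSMul η (WeakMVI.opAdd F WeakMVI.zeroOp)) x := by
      intro x
      rw [WeakMVI.zeroOp_eq_subdifferential, WeakMVI.opResolventSet_opAdd_eq_singleton hF
        Set.univ_nonempty convex_univ isClosed_univ hη hηL]
      rfl
    have hM := WeakMVI.one_le_outerOrder η ρ ε ‖x₀ - xs‖
    obtain ⟨hK1, hK2⟩ := WeakMVI.ceil_mul_outerOrder_bounds hM 9
    push_cast at hK1 hK2
    refine ⟨_, Nat.one_le_ceil_iff.2 (by linarith), hK2.trans (by linarith), ?_,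
      WeakMVI.fbfSolver_total_cost_le hη hηL hM (hK2.trans (by linarith))⟩
    obtain ⟨k, hk, hr⟩ := WeakMVI.relative_error_exists_residual_le hρ hρη hε
      (fun x => WeakMVI.inner_sub_ge_of_isWeakMVISolution hxs hη (hJ x))
      (fun k x => WeakMVI.norm_fbfSolver_sub_le hF hη hηL (hJ x) k) hK1
    exact ⟨k, hk, WeakMVI.norm_le_of_residual_le hF hη hηL (hJ _) hr⟩
  · rintro d F C _ L ρ η x₀ xs hF hc hcl rfl hρ hρη hηL hxs
    have hη : 0 < η := hρ.trans hρη
    have hκ := WeakMVI.one_le_kappa hη hηL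
    have hne : C.Nonempty := by
      obtain ⟨v, hv, -⟩ := hxs.1
      exact ⟨xs, (WeakMVI.mem_subdifferential_indicatorFn.1 hv).1⟩
    have hsing := WeakMVI.opResolventSet_opAdd_eq_singleton hF hne hc hcl hη hηL
    refine ⟨hsing, fun ε hε => ?_⟩
    have hmem : ∀ x, WeakMVI.opResolvent (WeakMVI.opSMul η (WeakMVI.opAdd F
        (WeakMVI.subdifferential (WeakMVI.indicatorFn C)))) x ∈ WeakMVI.opResolventSet
        (WeakMVI.opSMul η (WeakMVI.opAdd F
          (WeakMVI.subdifferential (WeakMVI.indicatorFn C)))) x := by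
      intro x
      rw [hsing]
      rfl
    have hJ := fun x => WeakMVI.inner_sub_ge_of_isWeakMVISolution hxs hη (hmem x)
    have htest := fun k x => WeakMVI.egStop_of_le hF hc hcl hη hηL (hmem x)
      (WeakMVI.tol_pos hη hε k) (Nat.le_ceil _)
    have htol : WeakMVI.MeetsTol F (WeakMVI.subdifferential (WeakMVI.indicatorFn C)) η ε
        (WeakMVI.egSolver F (WeakMVI.subdifferential (WeakMVI.indicatorFn C)) η L ε)
        (1 - ρ / η) x₀ := fun k =>
      WeakMVI.norm_egSolve_sub_le hF hc hcl hη hηL (hmem _) ⟨_, htest k _⟩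
    have hM := WeakMVI.one_le_outerOrder η ρ ε ‖x₀ - xs‖
    -- `K = ⌈36 M⌉` does not depend on the inner solver, so one `K` serves every `S`.
    obtain ⟨hK1, hK2⟩ := WeakMVI.ceil_mul_outerOrder_bounds hM 36
    push_cast at hK1 hK2
    rw [show (36 + 1 : ℝ) = 37 by norm_num] at hK2
    have hlog : 0 ≤ Real.log (WeakMVI.kappa η L * WeakMVI.outerOrder η ρ ε ‖x₀ - xs‖ *
        max 1 ε⁻¹) := by
      apply Real.log_nonneg
      have : 1 ≤ max 1 ε⁻¹ := le_max_left _ _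
      calc (1 : ℝ) = 1 * 1 * 1 := by ring
        _ ≤ _ := by gcongr
    refine ⟨fun k => ⟨_, htest k _⟩, htol, _, Nat.one_le_ceil_iff.2 (by linarith),
      hK2.trans (by linarith), ?_, fun S hS => ⟨fun K' hK' m hm => ?_, fun b hb hcost => ?_⟩⟩
    · refine (WeakMVI.absolute_error_cost_le hρ hρη hε hJ htol hκ (by norm_num : (0 : ℝ) ≤ 20)
        (fun k => WeakMVI.egSolve_cost_le hF hc hcl hη hηL (hmem _) (WeakMVI.tol_pos hη hε k))
        hK2).trans_eq ?_
      norm_num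
    · exact WeakMVI.best_iterate_residual_le hρ hρη hε hJ hS
        (hK1.trans (Nat.cast_le.2 hK')) hm
    · refine (WeakMVI.absolute_error_cost_le hρ hρη hε hJ hS hκ hb hcost hK2).trans ?_
      gcongr
      norm_num
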